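/- A *prefix-free machine* is a partial computable function $M$ from finite binary strings to finite binary strings such that no element of its domain is a proper prefix of another one. Fix a universal prefix-free machine $U$, that is, a prefix-free machine such that for every prefix-free machine $M$ there is a constant $c$ such that whenever $M(p)=x$, there is $q$ with $U(q)=x$ and $|q|\le |p|+c$. For a string $x$ let $K(x)=\min\{|p| : U(p)=x\}$ be its prefix-free Kolmogorov complexity, and for $n\in\mathbb N$ let $K(n)$ be the complexity of the binary expansion of $n$. For an infinite binary sequence $A$ let $A{\upharpoonright}n$ be its prefix of length $n$; $A$ is *$K$-trivial* if there is a constant $b$ with $K(A{\upharpoonright}n)\le K(n)+b$ for all $n$. A function $g\colon\mathbb N\to\mathbb R$ is *right-c.e.* if there is a computable function $(n,t)\mapsto g_t(n)$ with dyadic rational values such that for every $n$ the sequence $(g_t(n))_t$ is nonincreasing and converges to $g(n)$. It is a *weak Solovay function* if it is right-c.e., there is a constant $c$ with $K(n)\le g(n)+c$ for all $n$, and there is a constant $c'$ with $g(n)\le K(n)+c'$ for infinitely many $n$. **Theorem 4.7.** 1. If $g$ is a right-c.e. function with $K(n)\le g(n)+O(1)$ but $g$ is not a weak Solovay function, then the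 set $\{A : K(A{\upharpoonright}n)\le g(n)+O(1)\}$ is uncountable. 2. The set of $K$-trivial sequences is countable. 3. Consequently, if $g$ is a right-c.e. function such that for every sequence $A$ we have: $A$ is $K$-trivial if and only if $K(A{\upharpoonright}n)\le g(n)+O(1)$, then $g$ is a weak Solovay function. Here $K(A{\upharpoonright}n)\le g(n)+O(1)$ means that there is a constant $c$ (which may depend on $A$) such that $K(A{\upharpoonright}n)\le g(n)+c$ for all $n$. -/

import Mathlib

open Filter Topology

/-- A prefix-free machine: a partial computable function on binary strings
no two distinct elements of whose domain are comparable under the prefix relation. -/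
def IsPrefixFreeMachine (M : List Bool →. List Bool) : Prop :=
  Partrec M ∧ ∀ p q : List Bool, (M p).Dom → (M q).Dom → p <+: q → p = q

/-- A universal (that is, additively optimal) prefix-free machine: it is a prefix-free machine
and simulates each prefix-free machine with descriptions that are longer by at most
a constant. -/
def IsUniversalPrefixFreeMachine (U : List Bool →. List Bool) : Prop :=
  IsPrefixFreeMachine U ∧
    ∀ M : List Bool →. List Bool, IsPrefixFreeMachine M →
      ∃ c : ℕ, ∀ p x : List Bool, x ∈ M p → ∃ q : List Bool, x ∈ U q ∧ q.length ≤ p.length + c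

/-- Prefix-free Kolmogorov complexity `K(x)` of the string `x` with respect to `U`: the least
length of a `U`-description of `x`. For universal `U` every string has a description, so the
infimum is over a nonempty set. -/
noncomputable def prefixComplexity (U : List Bool →. List Bool) (x : List Bool) : ℕ :=
  sInf {k : ℕ | ∃ p : List Bool, x ∈ U p ∧ p.length = k}

/-- `K(n)` for a natural number `n`, which is identified with its binary expansion. -/
noncomputable def natPrefixComplexity (U : List Bool →. List Bool) (n : ℕ) : ℕ :=
  prefixComplexity U n.bits

/-- The prefix `A(0) ... A(n-1)` of length `n` of the sequence `A`. -/
def initialSegment (A : ℕ → Bool) (n : ℕ) : List Bool := (List.range n).map A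

/-- A real-valued function on `ℕ` is right-c.e. if it is the pointwise limit of a computable,
pointwise nonincreasing sequence of approximations; the approximation at stage `t` is the
dyadic rational `(a - b) / 2 ^ q`, given by the natural numbers `a`, `b`, `q`. -/
def IsRightCE (f : ℕ → ℝ) : Prop :=
  ∃ a b q : ℕ → ℕ → ℕ, Computable₂ a ∧ Computable₂ b ∧ Computable₂ q ∧
    ∀ n : ℕ, Antitone (fun t : ℕ => ((a n t : ℝ) - (b n t : ℝ)) / 2 ^ q n t) ∧
      Tendsto (fun t : ℕ => ((a n t : ℝ) - (b n t : ℝ)) / 2 ^ q n t) atTop (𝓝 (f n))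

/-- `K(n) ≤ g(n) + O(1)`. -/
def IsComplexityUpperBound (U : List Bool →. List Bool) (g : ℕ → ℝ) : Prop :=
  ∃ c : ℕ, ∀ n : ℕ, (natPrefixComplexity U n : ℝ) ≤ g n + c

/-- `g` is a weak Solovay function: it is right-c.e., `K(n) ≤ g(n) + O(1)`, and for some
constant `c` there are infinitely many `n` such that `g(n) ≤ K(n) + c`. -/
def IsWeakSolovay (U : List Bool →. List Bool) (g : ℕ → ℝ) : Prop :=
  IsRightCE g ∧ IsComplexityUpperBound U g ∧
    ∃ c : ℕ, {n : ℕ | g n ≤ (natPrefixComplexity U n : ℝ) + c}.Infinite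

/-- `A` is `g`-trivial: there is a constant `c` with `K(A ↾ n) ≤ g(n) + c` for all `n`. -/
def IsTrivialFor (U : List Bool →. List Bool) (g : ℕ → ℝ) (A : ℕ → Bool) : Prop :=
  ∃ c : ℕ, ∀ n : ℕ, (prefixComplexity U (initialSegment A n) : ℝ) ≤ g n + c

/-- `A` is `K`-trivial: there is a constant `b` with `K(A ↾ n) ≤ K(n) + b` for all `n`. -/
def IsKTrivial (U : List Bool →. List Bool) (A : ℕ → Bool) : Prop :=
  ∃ b : ℕ, ∀ n : ℕ, prefixComplexity U (initialSegment A n) ≤ natPrefixComplexity U n + b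

namespace UniversalMachine
open Nat.Partrec (Code)
open Encodable Denumerable

/-- One of the two strings is a prefix of the other. -/
def comparable (p q : List Bool) : Prop := p.take q.length = q ∨ q.take p.length = p
instance : DecidableRel comparable := fun p q => by unfold comparable; infer_instance

/-- Within `s` steps the computation `e` halts on the string with code `m`, and that string is
distinct from `p` but comparable with it. -/
def blocks (e : Code) (s : ℕ) (p : List Bool) (m : ℕ) : Prop :=
  (Code.evaln s e m).isSome = true ∧ ∃ q ∈ (decode (α := List Bool) m).toList,
    q ≠ p ∧ comparable p q

/-- The output of `e` on `p` after `s` steps, unless `p` is blocked. -/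
noncomputable def step (e : Code) (p : List Bool) (s : ℕ) : Option ℕ := by
  classical
  exact if ∀ m < s, ¬ blocks e s p m then Code.evaln s e (encode p) else none

/-- The computation `e` restricted to a prefix-free domain. -/
noncomputable def pf (e : Code) (p : List Bool) : Part (List Bool) :=
  (Nat.rfindOpt (step e p)).bind fun x => Part.ofOption (decode x)

theorem blocks_prim : PrimrecRel fun (m : ℕ) (a : Code × List Bool × ℕ) =>
    blocks a.1 a.2.2 a.2.1 m := by
  have h1 : PrimrecPred fun x : ℕ × (Code × List Bool × ℕ) =>
      (Code.evaln x.2.2.2 x.2.1 x.1).isSome = true := by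
    have h : Primrec fun x : ℕ × (Code × List Bool × ℕ) => ((x.2.2.2, x.2.1), x.1) :=
      (((Primrec.snd.comp (Primrec.snd.comp Primrec.snd)).pair
        (Primrec.fst.comp Primrec.snd)).pair Primrec.fst)
    exact Primrec.eq.comp (Primrec.option_isSome.comp (Code.primrec_evaln.comp h))
      (Primrec.const true)
  have h2 : PrimrecRel fun (q p : List Bool) => q ≠ p ∧ comparable p q := by
    refine PrimrecPred.and (PrimrecPred.not (Primrec.eq.comp Primrec.fst Primrec.snd)) ?_
    refine PrimrecPred.or ?_ ?_
    · exact Primrec.eq.comp (Primrec.list_take.comp (Primrec.list_length.comp Primrec.fst)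
        Primrec.snd) Primrec.fst
    · exact Primrec.eq.comp (Primrec.list_take.comp (Primrec.list_length.comp Primrec.snd)
        Primrec.fst) Primrec.snd
  have h3 := h2.exists_mem_list
  have h4 : PrimrecPred fun x : ℕ × (Code × List Bool × ℕ) =>
      ∃ q ∈ (decode (α := List Bool) x.1).toList, q ≠ x.2.2.1 ∧ comparable x.2.2.1 q :=
    h3.comp (Primrec.optionToList.comp (Primrec.decode.comp Primrec.fst))
      (Primrec.fst.comp (Primrec.snd.comp Primrec.snd))
  exact h1.and h4

theorem step_prim : Primrec fun a : Code × List Bool × ℕ => step a.1 a.2.1 a.2.2 := by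
  classical
  have h : PrimrecPred fun a : Code × List Bool × ℕ => ∀ m < a.2.2, ¬ blocks a.1 a.2.2 a.2.1 m :=
    ((PrimrecRel.forall_mem_list (R := fun (m : ℕ) (a : Code × List Bool × ℕ) =>
      ¬ blocks a.1 a.2.2 a.2.1 m) (PrimrecPred.not blocks_prim)).comp
      (Primrec.list_range.comp (Primrec.snd.comp Primrec.snd)) Primrec.id).of_eq
      fun a => by simp
  have h2 : Primrec fun a : Code × List Bool × ℕ => Code.evaln a.2.2 a.1 (encode a.2.1) :=
    Code.primrec_evaln.comp (((Primrec.snd.comp Primrec.snd).pair Primrec.fst).pair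
      (Primrec.encode.comp (Primrec.fst.comp Primrec.snd)))
  refine (Primrec.ite h h2 (Primrec.const none)).of_eq fun a => ?_
  unfold step
  congr

theorem pf_partrec : Partrec₂ pf := by
  refine Partrec.bind (Partrec.rfindOpt (f := fun (a : Code × List Bool) s => step a.1 a.2 s) ?_) ?_
  · exact (step_prim.comp ((Primrec.fst.comp Primrec.fst).pair
      ((Primrec.snd.comp Primrec.fst).pair Primrec.snd))).to_comp
  · exact (Computable.ofOption (Primrec.decode.to_comp.comp Computable.snd)).to₂

theorem step_some {e : Code} {p : List Bool} {s x : ℕ} :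
    step e p s = some x ↔ (∀ m < s, ¬ blocks e s p m) ∧ Code.evaln s e (encode p) = some x := by
  classical
  unfold step
  split_ifs with h
  · exact ⟨fun h' => ⟨h, h'⟩, fun h' => h'.2⟩
  · simp [h]

theorem pf_prefixFree (e : Code) (p q : List Bool) (hp : (pf e p).Dom) (hq : (pf e q).Dom)
    (hpq : p <+: q) : p = q := by
  obtain ⟨h1, -⟩ := hp
  obtain ⟨h2, -⟩ := hq
  obtain ⟨s, x, hs⟩ := Nat.rfindOpt_dom.1 h1
  obtain ⟨t, y, ht⟩ := Nat.rfindOpt_dom.1 h2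
  obtain ⟨a1, a2⟩ := step_some.1 hs
  obtain ⟨b1, b2⟩ := step_some.1 ht
  by_contra hne
  have hc : q.take p.length = p := (List.prefix_iff_eq_take.1 hpq).symm
  rcases le_total s t with h | h
  · have := Code.evaln_mono h a2
    refine b1 _ (Code.evaln_bound this) ⟨by rw [Option.mem_def.1 this]; rfl, p, by simp, hne, Or.inl hc⟩
  · have := Code.evaln_mono h b2
    refine a1 _ (Code.evaln_bound this) ⟨by rw [Option.mem_def.1 this]; rfl, q, by simp, Ne.symm hne, Or.inr hc⟩

theorem pf_complete (M : List Bool →. List Bool) (hM : IsPrefixFreeMachine M) :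
    ∃ e : Code, ∀ p x, x ∈ M p → x ∈ pf e p := by
  obtain ⟨e, he⟩ := Code.exists_code.1 hM.1
  have he' : ∀ p, Code.eval e (encode p) = (M p).map encode := by
    intro p; rw [he]; simp
  refine ⟨e, fun p x hx => ?_⟩
  have h0 : encode x ∈ Code.eval e (encode p) := by
    rw [he']; exact Part.mem_map _ hx
  obtain ⟨s, hs⟩ := Code.evaln_complete.1 h0
  have hst : step e p s = some (encode x) := by
    refine step_some.2 ⟨?_, hs⟩
    rintro m - ⟨hm, q, hq, hne, hc⟩
    obtain ⟨y, hy⟩ := Option.isSome_iff_exists.1 hm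
    have hy := Code.evaln_sound hy
    rw [he] at hy
    have hd : decode (α := List Bool) m = some q := by simpa using hq
    simp [hd] at hy
    obtain ⟨z, hz, -⟩ := hy
    have hdq : (M q).Dom := Part.dom_iff_mem.2 ⟨z, hz⟩
    have hdp : (M p).Dom := Part.dom_iff_mem.2 ⟨x, hx⟩
    rcases hc with hc | hc
    · exact hne (hM.2 q p hdq hdp (List.prefix_iff_eq_take.2 hc.symm))
    · exact hne (hM.2 p q hdp hdq (List.prefix_iff_eq_take.2 hc.symm)).symm
  have hdom : (Nat.rfindOpt (step e p)).Dom := Nat.rfindOpt_dom.2 ⟨s, _, hst⟩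
  obtain ⟨y, hy⟩ := Part.dom_iff_mem.1 hdom
  obtain ⟨t, ht⟩ := Nat.rfindOpt_spec hy
  have hy2 := Code.evaln_sound (step_some.1 ht).2
  have := Part.mem_unique hy2 h0
  subst this
  exact Part.mem_bind_iff.2 ⟨_, hy, by simp⟩

/-- On input `1^e 0 p` run the `e`-th prefix-free computation on `p`. -/
noncomputable def univ (l : List Bool) : Part (List Bool) :=
  (Part.ofOption l[l.findIdx (fun b => !b)]?).bind fun _ =>
    pf (ofNat Code (l.findIdx (fun b => !b))) (l.drop (l.findIdx (fun b => !b) + 1))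

theorem univ_partrec : Partrec univ := by
  have hi : Computable fun l : List Bool => l.findIdx (fun b => !b) :=
    (Primrec.list_findIdx Primrec.id (Primrec.not.comp Primrec.snd).to₂).to_comp
  refine Partrec.bind (Computable.ofOption (Computable.list_getElem?.comp Computable.id hi)) ?_
  have h1 : Computable fun a : List Bool × Bool =>
      ofNat Code (a.1.findIdx (fun b => !b)) :=
    (Computable.ofNat Code).comp (hi.comp Computable.fst)
  have h2 : Computable fun a : List Bool × Bool =>
      a.1.drop (a.1.findIdx (fun b => !b) + 1) :=
    Computable₂.comp (f := List.drop) Primrec.list_drop.to_comp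
      (Computable.succ.comp (hi.comp Computable.fst)) Computable.fst
  exact (Partrec₂.comp pf_partrec h1 h2).to₂

/-- There is a universal prefix-free machine. -/
theorem exists_universal : ∃ U, IsUniversalPrefixFreeMachine U := by
  refine ⟨univ, ⟨univ_partrec, ?_⟩, ?_⟩
  · rintro p q hp hq ⟨r, rfl⟩
    obtain ⟨h1, h2⟩ := hp
    obtain ⟨h3, h4⟩ := hq
    have hlt : p.findIdx (fun b => !b) < p.length := by
      by_contra hcon
      rw [List.getElem?_eq_none (not_lt.1 hcon)] at h1
      exact h1.elim
    have hfi : (p ++ r).findIdx (fun b => !b) = p.findIdx (fun b => !b) := by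
      rw [List.findIdx_append, if_pos hlt]
    dsimp only at h4
    rw [hfi] at h4
    have hd : (p ++ r).drop (p.findIdx (fun b => !b) + 1)
        = p.drop (p.findIdx (fun b => !b) + 1) ++ r := List.drop_append_of_le_length hlt
    have := pf_prefixFree _ _ _ h2 h4 (by rw [hd]; exact List.prefix_append _ _)
    rw [hd] at this
    simpa using this
  · intro M hM
    obtain ⟨e, he⟩ := pf_complete M hM
    refine ⟨encode e + 1, fun p x hx =>
      ⟨List.replicate (encode e) true ++ false :: p, ?_, by simp; omega⟩⟩
    have hfi : (List.replicate (encode e) true ++ false :: p).findIdx (fun b => !b) = encode e := by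
      generalize encode e = k
      induction k with
      | zero => simp [List.findIdx_cons]
      | succ k ih => simpa [List.replicate_succ, List.findIdx_cons] using ih
    unfold univ
    rw [hfi]
    simp
    have hd : (List.replicate (encode e) true ++ false :: p).drop (encode e + 1) = p := by
      simp [List.drop_append]
    rw [hd]
    exact he p x hx

end UniversalMachine

/-! Countability is a counting argument. The total weight of the descriptions of strings of length
n, as a function of n, is a semimeasure that can be enumerated from below, so the Kraft–Chaitin
theorem bounds it by O(2^(-K(n))) (`exists_coding_bound`). Hence only O(2^b) strings of length n
have complexity at most K(n) + b (`exists_card_le`), and for each b only finitely many sequences are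
K-trivial with constant b.

For uncountability, let `G n s` be a nonincreasing integer approximation whose limit is g(n) up to a
constant, and let `H n s` decrease to K(n). If g is not a weak Solovay function, then G - K tends to
infinity. The aim is to find markers p 0 < p 1 < ... such that every set of markers is g-trivial.
For a length n in [p m, p (m + 1)) there are 2^(m+1) candidate prefixes, and each needs a
description of length about `G n s` whenever that value drops. These descriptions are affordable if
the increase of `alpha`, the sum of the weights 2^(-G n s), that is paid for at level m is at most
about 2^(-2m).

The stage after which `alpha` grows so little is not computable, so it is guessed, and wrong guesses
cost weight. The accounting compares `alpha` with `beta`, which is bounded by 1 and counts n with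
weight 2^(-H n s), but with at most 2^(2k) times its weight in `alpha`. The process with parameter k
restarts when the growth of `alpha` since the last restart reaches 2^(-k) times the growth of `beta`
over the preceding period. These allowances telescope, so the total spent is at most 2^(-k), however
many restarts occur (`sum_growth_le`). There are only finitely many restarts: since G - K is at
least 2k almost everywhere, late tails of `beta` are at least 2^(2k) times those of `alpha`, whereas
infinitely many restarts would make them at most 2^k times as large (`exists_restarts_le`). So the
markers, which are built from restart times, converge.

The last claim follows because the zero sequence is K-trivial, which forces K(n) ≤ g(n) + O(1). -/

open scoped ENNReal

-- Closure properties of computable functions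

attribute [fun_prop] Computable
attribute [fun_prop] Computable.id Computable.const Computable.comp Computable.pair
  Computable.fst Computable.snd Computable.cond

namespace Computable

variable {α β σ : Type*} [Primcodable α] [Primcodable β] [Primcodable σ]

@[fun_prop] theorem fst_apply {f : α → β × σ} (hf : Computable f) :
    Computable fun a => (f a).1 := fst.comp hf

@[fun_prop] theorem snd_apply {f : α → β × σ} (hf : Computable f) :
    Computable fun a => (f a).2 := snd.comp hf

@[fun_prop] theorem unpair_apply {f : α → ℕ} (hf : Computable f) :
    Computable fun a => (f a).unpair := unpair.comp hf

@[fun_prop] theorem some_apply {f : α → β} (hf : Computable f) :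
    Computable fun a => some (f a) := option_some.comp hf

@[fun_prop] theorem isSome_apply {f : α → Option β} (hf : Computable f) :
    Computable fun a => (f a).isSome := Primrec.option_isSome.to_comp.comp hf

@[fun_prop] theorem append_apply {f g : α → List β} (hf : Computable f) (hg : Computable g) :
    Computable fun a => f a ++ g a := list_append.comp hf hg

@[fun_prop] theorem cons_apply {f : α → β} {g : α → List β} (hf : Computable f)
    (hg : Computable g) : Computable fun a => f a :: g a := list_cons.comp hf hg

@[fun_prop] theorem length_apply {f : α → List β} (hf : Computable f) :
    Computable fun a => (f a).length := list_length.comp hf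

@[fun_prop] theorem add_apply {f g : α → ℕ} (hf : Computable f) (hg : Computable g) :
    Computable fun a => f a + g a := Primrec.nat_add.to_comp.comp hf hg

@[fun_prop] theorem sub_apply {f g : α → ℕ} (hf : Computable f) (hg : Computable g) :
    Computable fun a => f a - g a := Primrec.nat_sub.to_comp.comp hf hg

@[fun_prop] theorem mul_apply {f g : α → ℕ} (hf : Computable f) (hg : Computable g) :
    Computable fun a => f a * g a := Primrec.nat_mul.to_comp.comp hf hg

@[fun_prop] theorem div_apply {f g : α → ℕ} (hf : Computable f) (hg : Computable g) :
    Computable fun a => f a / g a := Primrec.nat_div.to_comp.comp hf hg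

@[fun_prop] theorem mod_apply {f g : α → ℕ} (hf : Computable f) (hg : Computable g) :
    Computable fun a => f a % g a := Primrec.nat_mod.to_comp.comp hf hg

@[fun_prop] theorem max_apply {f g : α → ℕ} (hf : Computable f) (hg : Computable g) :
    Computable fun a => max (f a) (g a) := Primrec.nat_max.to_comp.comp hf hg

@[fun_prop] theorem min_apply {f g : α → ℕ} (hf : Computable f) (hg : Computable g) :
    Computable fun a => min (f a) (g a) := Primrec.nat_min.to_comp.comp hf hg

@[fun_prop] theorem pow_apply {f g : α → ℕ} (hf : Computable f) (hg : Computable g) :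
    Computable fun a => f a ^ g a :=
  (Primrec₂.unpaired'.1 Nat.Primrec.pow).to_comp.comp hf hg

@[fun_prop] theorem decide_le {f g : α → ℕ} (hf : Computable f) (hg : Computable g) :
    Computable fun a => decide (f a ≤ g a) := Primrec.nat_le.decide.to_comp.comp hf hg

@[fun_prop] theorem decide_lt {f g : α → ℕ} (hf : Computable f) (hg : Computable g) :
    Computable fun a => decide (f a < g a) := Primrec.nat_lt.decide.to_comp.comp hf hg

@[fun_prop] theorem decide_eq [DecidableEq β] {f g : α → β} (hf : Computable f)
    (hg : Computable g) : Computable fun a => decide (f a = g a) :=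
  Primrec.eq.decide.to_comp.comp hf hg

@[fun_prop] theorem not_apply {f : α → Bool} (hf : Computable f) :
    Computable fun a => !(f a) := Primrec.not.to_comp.comp hf

@[fun_prop] theorem and_apply {f g : α → Bool} (hf : Computable f) (hg : Computable g) :
    Computable fun a => f a && g a := Primrec.and.to_comp.comp hf hg

@[fun_prop] theorem or_apply {f g : α → Bool} (hf : Computable f) (hg : Computable g) :
    Computable fun a => f a || g a := Primrec.or.to_comp.comp hf hg

@[fun_prop] theorem testBit_apply {f g : α → ℕ} (hf : Computable f) (hg : Computable g) :
    Computable fun a => (f a).testBit (g a) := by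
  simp only [Nat.testBit_eq_decide_div_mod_eq]
  fun_prop

@[fun_prop] theorem bodd_apply {f : α → ℕ} (hf : Computable f) :
    Computable fun a => (f a).bodd := nat_bodd.comp hf

@[fun_prop] theorem div2_apply {f : α → ℕ} (hf : Computable f) :
    Computable fun a => (f a).div2 := nat_div2.comp hf

theorem option_elim_apply {f : α → Option β} {c : α → σ} {g : α → β → σ} (hf : Computable f)
    (hc : Computable c) (hg : Computable fun p : α × β => g p.1 p.2) :
    Computable fun a => (f a).elim (c a) (g a) :=
  (option_casesOn hf hc (show Computable₂ g from hg)).of_eq fun a => by cases f a <;> rfl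

theorem sum_range {f : α → ℕ → ℕ} {h : α → ℕ} (hf : Computable fun p : α × ℕ => f p.1 p.2)
    (hh : Computable h) : Computable fun a => ∑ i ∈ Finset.range (h a), f a i := by
  refine (nat_rec (f := h) (g := fun _ : α => (0 : ℕ))
    (h := fun a p => p.2 + f a p.1) hh (const 0) ?_).of_eq fun a => ?_
  · have : Computable fun q : α × (ℕ × ℕ) => f q.1 q.2.1 :=
      hf.comp (f := fun p : α × ℕ => f p.1 p.2) (g := fun q : α × (ℕ × ℕ) => (q.1, q.2.1))
        (by fun_prop)
    exact (by fun_prop : Computable fun q : α × (ℕ × ℕ) => q.2.2 + f q.1 q.2.1)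
  · induction h a with
    | zero => simp
    | succ n ih => rw [Finset.sum_range_succ, ← ih]

theorem any_range {f : α → ℕ → Bool} {h : α → ℕ} (hf : Computable fun p : α × ℕ => f p.1 p.2)
    (hh : Computable h) : Computable fun a => (List.range (h a)).any (f a) := by
  refine (nat_rec (f := h) (g := fun _ : α => false)
    (h := fun a p => p.2 || f a p.1) hh (const false) ?_).of_eq fun a => ?_
  · have : Computable fun q : α × (ℕ × Bool) => f q.1 q.2.1 :=
      hf.comp (f := fun p : α × ℕ => f p.1 p.2) (g := fun q : α × (ℕ × Bool) => (q.1, q.2.1))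
        (by fun_prop)
    exact (by fun_prop : Computable fun q : α × (ℕ × Bool) => q.2.2 || f q.1 q.2.1)
  · induction h a with
    | zero => simp
    | succ n ih => rw [List.range_succ, List.any_append, ← ih]; simp

theorem map_range {f : α → ℕ → β} {h : α → ℕ} (hf : Computable fun p : α × ℕ => f p.1 p.2)
    (hh : Computable h) : Computable fun a => (List.range (h a)).map (f a) := by
  refine (nat_rec (f := h) (g := fun _ : α => ([] : List β))
    (h := fun a p => p.2 ++ [f a p.1]) hh (const []) ?_).of_eq fun a => ?_
  · have : Computable fun q : α × (ℕ × List β) => f q.1 q.2.1 :=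
      hf.comp (f := fun p : α × ℕ => f p.1 p.2) (g := fun q : α × (ℕ × List β) => (q.1, q.2.1))
        (by fun_prop)
    exact (by fun_prop : Computable fun q : α × (ℕ × List β) => q.2.2 ++ [f q.1 q.2.1])
  · induction h a with
    | zero => simp
    | succ n ih => rw [List.range_succ, List.map_append, ← ih]; simp

/-- The binary expansion of a natural number is computable. -/
theorem nat_bits : Computable Nat.bits := by
  have key : ∀ n : ℕ, n ≠ 0 → n.bits = n.bodd :: n.div2.bits := fun n hn => by
    conv_lhs => rw [← Nat.bit_bodd_div2 n]
    refine Nat.bits_append_bit _ _ fun h => ?_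
    by_contra hb
    rw [← Nat.bit_bodd_div2 n, h] at hn
    simp only [Bool.not_eq_true] at hb
    simp [hb] at hn
  -- The state holds the digits found so far and the remaining quotient. The quotient is at most n -
  -- i after i halvings, so n rounds always suffice.
  let F : ℕ → ℕ → List Bool × ℕ := fun n i => Nat.rec ([], n)
    (fun _ q => bif decide (q.2 = 0) then q else (q.1 ++ [q.2.bodd], q.2.div2)) i
  have hF : Computable fun n => (F n n).1 := by
    refine fst.comp (nat_rec (f := fun n : ℕ => n) (g := fun n : ℕ => (([] : List Bool), n))
      (h := fun _ p => bif decide (p.2.2 = 0) then p.2 else (p.2.1 ++ [p.2.2.bodd], p.2.2.div2))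
      (by fun_prop) (by fun_prop) ?_)
    exact (by fun_prop : Computable fun q : ℕ × ℕ × (List Bool × ℕ) =>
      bif decide (q.2.2.2 = 0) then q.2.2 else (q.2.2.1 ++ [q.2.2.2.bodd], q.2.2.2.div2))
  refine hF.of_eq fun n => ?_
  have inv : ∀ i, (F n i).1 ++ (F n i).2.bits = n.bits ∧ (F n i).2 ≤ n - i := by
    intro i
    induction i with
    | zero => simp [F]
    | succ i ih =>
      have hs : F n (i + 1) = bif decide ((F n i).2 = 0) then F n i else
        ((F n i).1 ++ [(F n i).2.bodd], (F n i).2.div2) := rfl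
      by_cases h0 : (F n i).2 = 0
      · rw [hs]
        simp only [h0, decide_true, cond_true]
        exact ⟨by simpa [h0] using ih.1, by omega⟩
      · rw [hs]
        simp only [h0, decide_false, cond_false]
        refine ⟨by rw [← ih.1, key _ h0]; simp, ?_⟩
        have := ih.2
        rw [Nat.div2_val]
        omega
  have h1 := inv n
  have h2 : (F n n).2 = 0 := by omega
  simpa [h2] using h1.1

@[fun_prop] theorem bits_apply {f : α → ℕ} (hf : Computable f) :
    Computable fun a => (f a).bits := nat_bits.comp hf

end Computable

/-! ### Decoding binary expansions and enumerating machines -/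

/-- The inverse of `Nat.bits`. -/
def bitsToNat (l : List Bool) : ℕ := l.foldr (fun b n => 2 * n + b.toNat) 0

theorem bitsToNat_bits (n : ℕ) : bitsToNat n.bits = n := by
  induction n using Nat.binaryRec' with
  | zero => rfl
  | bit b n h ih =>
    rw [Nat.bits_append_bit n b h]
    simp only [bitsToNat, List.foldr_cons] at ih ⊢
    rw [ih, Nat.bit_val]

theorem computable_bitsToNat : Computable bitsToNat := by
  refine (Primrec.list_foldr (f := fun l : List Bool => l) (g := fun _ => 0)
    (h := fun _ p => 2 * p.2 + p.1.toNat) Primrec.id (Primrec.const 0) ?_).to_comp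
  refine Primrec.nat_add.comp (Primrec.nat_mul.comp (Primrec.const 2)
    (Primrec.snd.comp Primrec.snd)) ((Primrec.dom_bool Bool.toNat).comp
    (Primrec.fst.comp Primrec.snd))

/-- The graph of a partial computable function has a computable enumeration that visits each
argument at most once. -/
theorem exists_enumeration_of_partrec {U : List Bool →. List Bool} (hU : Partrec U) :
    ∃ E : ℕ → Option (List Bool × List Bool), Computable E ∧
      (∀ i p x, E i = some (p, x) → x ∈ U p) ∧ (∀ p x, x ∈ U p → ∃ i, E i = some (p, x)) ∧
      ∀ i j p x y, E i = some (p, x) → E j = some (p, y) → i = j := by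
  open Nat.Partrec Encodable in
  obtain ⟨e, he⟩ := Code.exists_code.1 hU
  have he' : ∀ p, Code.eval e (encode p) = (U p).map encode := fun p => by rw [he]; simp
  have hev : Computable fun p : ℕ × ℕ => Code.evaln p.2 e p.1 :=
    (Code.primrec_evaln.comp ((Primrec.snd.pair (Primrec.const e)).pair Primrec.fst)).to_comp
  have hd : Computable fun m : ℕ => decode₂ (List Bool) m := Primrec.decode₂.to_comp
  -- The index codes an input and a step bound s. An output occurs only if the computation is still
  -- undefined at bound s and defined at s + 1, which singles out one s for each input. `decode₂`
  -- excludes numbers that are not themselves codes of strings.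
  let E : ℕ → Option (List Bool × List Bool) := fun i =>
    bif (Code.evaln i.unpair.2 e i.unpair.1).isSome then none else
      (Code.evaln (i.unpair.2 + 1) e i.unpair.1).bind fun v =>
        (decode₂ (List Bool) i.unpair.1).bind fun p => (decode₂ (List Bool) v).map fun x => (p, x)
  have hE : ∀ i p x, E i = some (p, x) ↔ i.unpair.1 = encode p ∧
      Code.evaln i.unpair.2 e (encode p) = (none : Option ℕ) ∧
      Code.evaln (i.unpair.2 + 1) e (encode p) = some (encode x) := by
    intro i p x
    simp only [E]
    cases h : Code.evaln i.unpair.2 e i.unpair.1 with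
    | some v =>
      simp only [Option.isSome_some, cond_true, reduceCtorEq, false_iff]
      rintro ⟨h1, h2, -⟩
      rw [h1, h2] at h
      cases h
    | none =>
      simp only [Option.isSome_none, cond_false, Option.bind_eq_some_iff, Option.map_eq_some_iff,
        decode₂_eq_some, Prod.mk.injEq]
      constructor
      · rintro ⟨v, hv, p', hp', x', hx', rfl, rfl⟩
        rw [← hp'] at h hv
        exact ⟨hp'.symm, h, by rw [hv, hx']⟩
      · rintro ⟨h1, h2, h3⟩
        exact ⟨_, by rw [h1, h3], p, h1.symm, x, rfl, rfl, rfl⟩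
  refine ⟨E, ?_, ?_, ?_, ?_⟩
  · have h1 : Computable fun i : ℕ => Code.evaln i.unpair.2 e i.unpair.1 :=
      hev.comp (f := fun p : ℕ × ℕ => Code.evaln p.2 e p.1)
        (g := fun i : ℕ => (i.unpair.1, i.unpair.2)) (by fun_prop)
    have h2 : Computable fun i : ℕ => Code.evaln (i.unpair.2 + 1) e i.unpair.1 :=
      hev.comp (f := fun p : ℕ × ℕ => Code.evaln p.2 e p.1)
        (g := fun i : ℕ => (i.unpair.1, i.unpair.2 + 1)) (by fun_prop)
    refine Computable.cond (by fun_prop) (by fun_prop) (Computable.option_bind h2 ?_)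
    refine Computable.option_bind (hd.comp (by fun_prop)) ?_
    refine Computable.option_map (hd.comp (by fun_prop)) ?_
    exact (by fun_prop : Computable fun q : ((ℕ × ℕ) × List Bool) × List Bool => (q.1.2, q.2))
  · intro i p x h
    obtain ⟨-, -, h3⟩ := (hE i p x).1 h
    have := Code.evaln_sound h3
    rw [he', Part.mem_map_iff] at this
    obtain ⟨y, hy, hxy⟩ := this
    rwa [encode_injective hxy] at hy
  · intro p x h
    have : encode x ∈ Code.eval e (encode p) := by rw [he']; exact Part.mem_map _ h
    have hs := Code.evaln_complete.1 this
    classical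
    have hmin := Nat.find_spec hs
    obtain ⟨s, hs'⟩ : ∃ s, Nat.find hs = s + 1 := by
      refine Nat.exists_eq_succ_of_ne_zero fun h0 => ?_
      rw [h0] at hmin
      simp [Code.evaln] at hmin
    refine ⟨Nat.pair (encode p) s, (hE _ _ _).2 ⟨by simp, ?_, ?_⟩⟩
    · simp only [Nat.unpair_pair]
      refine Option.eq_none_iff_forall_not_mem.2 fun v hv => ?_
      have hv' := Part.mem_unique (Code.evaln_sound hv) this
      subst hv'
      exact Nat.find_min hs (m := s) (by omega) hv
    · simp only [Nat.unpair_pair]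
      rw [hs'] at hmin
      exact hmin
  · intro i j p x y hi hj
    obtain ⟨hi1, hi2, hi3⟩ := (hE _ _ _).1 hi
    obtain ⟨hj1, hj2, hj3⟩ := (hE _ _ _).1 hj
    have hlt : ∀ a b z, Code.evaln a e (encode p) = (none : Option ℕ) →
        Code.evaln (b + 1) e (encode p) = some z → a ≤ b := by
      intro a b z ha hb
      by_contra hab
      have := Code.evaln_mono (show b + 1 ≤ a by omega) hb
      rw [Option.mem_def, ha] at this
      cases this
    have hs : i.unpair.2 = j.unpair.2 := le_antisymm (hlt _ _ _ hi2 hj3) (hlt _ _ _ hj2 hi3)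
    rw [← Nat.pair_unpair i, ← Nat.pair_unpair j, hs, hi1, hj1]

/-! ### Basic properties of prefix-free complexity -/

section Complexity

variable {U : List Bool →. List Bool}

theorem IsUniversalPrefixFreeMachine.exists_program (hU : IsUniversalPrefixFreeMachine U)
    (x : List Bool) : ∃ p, x ∈ U p := by
  have hM : IsPrefixFreeMachine fun p => ((bif decide (p = []) then some x else none : Option _) :
      Part (List Bool)) := by
    refine ⟨Computable.ofOption (by fun_prop), fun p q hp hq _ => ?_⟩
    have key : ∀ p : List Bool, ((bif decide (p = []) then some x else none : Option _) :
        Part (List Bool)).Dom → p = [] := fun p hp => by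
      by_contra h
      simp [h] at hp
    rw [key p hp, key q hq]
  obtain ⟨c, hc⟩ := hU.2 _ hM
  obtain ⟨q, hq, -⟩ := hc [] x (by simp)
  exact ⟨q, hq⟩

theorem prefixComplexity_le {p x : List Bool} (h : x ∈ U p) :
    prefixComplexity U x ≤ p.length := Nat.sInf_le ⟨p, h, rfl⟩

theorem IsUniversalPrefixFreeMachine.exists_length_eq (hU : IsUniversalPrefixFreeMachine U)
    (x : List Bool) : ∃ p, x ∈ U p ∧ p.length = prefixComplexity U x :=
  Nat.sInf_mem (s := {k : ℕ | ∃ p : List Bool, x ∈ U p ∧ p.length = k})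
    (let ⟨p, hp⟩ := hU.exists_program x; ⟨p.length, p, hp, rfl⟩)

theorem IsUniversalPrefixFreeMachine.exists_le_of_machine (hU : IsUniversalPrefixFreeMachine U)
    {M : List Bool →. List Bool} (hM : IsPrefixFreeMachine M) :
    ∃ c, ∀ p x, x ∈ M p → prefixComplexity U x ≤ p.length + c := by
  obtain ⟨c, hc⟩ := hU.2 M hM
  refine ⟨c, fun p x hx => ?_⟩
  obtain ⟨q, hq, hle⟩ := hc p x hx
  exact (prefixComplexity_le hq).trans hle

theorem IsUniversalPrefixFreeMachine.exists_map_le (hU : IsUniversalPrefixFreeMachine U)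
    {f : List Bool → List Bool} (hf : Computable f) :
    ∃ c, ∀ x, prefixComplexity U (f x) ≤ prefixComplexity U x + c := by
  obtain ⟨c, hc⟩ := hU.exists_le_of_machine (M := fun p => (U p).map f)
    ⟨hU.1.1.map (hf.comp Computable.snd).to₂, fun p q hp hq h => hU.1.2 p q hp hq h⟩
  refine ⟨c, fun x => ?_⟩
  obtain ⟨p, hp, hlen⟩ := hU.exists_length_eq x
  rw [← hlen]
  exact hc p _ (Part.mem_map f hp)

end Complexity

/-! ### Kraft's inequality -/

section Kraft

/-- Kraft's inequality for finite prefix-free sets of binary strings. -/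
theorem sum_two_pow_length_le_one {S : Finset (List Bool)}
    (hS : ∀ p ∈ S, ∀ q ∈ S, p <+: q → p = q) : ∑ p ∈ S, (1 / 2 : ℝ) ^ p.length ≤ 1 := by
  -- The empty string is set aside because it destroys unique decodability. Without it, a
  -- prefix-free set is uniquely decodable, and the Kraft–McMillan inequality applies.
  by_cases h0 : [] ∈ S
  · have : S = {[]} := Finset.eq_singleton_iff_unique_mem.2
      ⟨h0, fun q hq => (hS _ h0 q hq List.nil_prefix).symm⟩
    simp [this]
  have hd : InformationTheory.UniquelyDecodable (S : Set (List Bool)) := by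
    intro L₁
    induction L₁ with
    | nil =>
      intro L₂ _ h2 h
      cases L₂ with
      | nil => rfl
      | cons w L₂ =>
        simp only [List.flatten_nil, List.flatten_cons] at h
        have hw : w = [] := (List.append_eq_nil_iff.1 h.symm).1
        exact absurd (hw ▸ h2 w (by simp)) h0
    | cons v L₁ ih =>
      intro L₂ h1 h2 h
      cases L₂ with
      | nil =>
        simp only [List.flatten_nil, List.flatten_cons] at h
        have hv : v = [] := (List.append_eq_nil_iff.1 h).1
        exact absurd (hv ▸ h1 v (by simp)) h0
      | cons w L₂ =>
        simp only [List.flatten_cons] at h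
        have hvw : v = w := by
          have hv : v <+: v ++ L₁.flatten := List.prefix_append _ _
          have hw : w <+: v ++ L₁.flatten := h ▸ List.prefix_append _ _
          rcases List.prefix_or_prefix_of_prefix hv hw with hp | hp
          · exact hS v (h1 v (by simp)) w (h2 w (by simp)) hp
          · exact (hS w (h2 w (by simp)) v (h1 v (by simp)) hp).symm
        subst hvw
        rw [ih L₂ (fun u hu => h1 u (by simp [hu])) (fun u hu => h2 u (by simp [hu]))
          (List.append_cancel_left h)]
  simpa using InformationTheory.kraft_mcmillan_inequality hd

/-- Each program is listed at most once, so every finite partial sum is a Kraft sum over a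
prefix-free set. -/
theorem tsum_enumeration_le_one {U : List Bool →. List Bool} (hU : IsPrefixFreeMachine U)
    {E : ℕ → Option (List Bool × List Bool)} (hmem : ∀ i p x, E i = some (p, x) → x ∈ U p)
    (hinj : ∀ i j p x y, E i = some (p, x) → E j = some (p, y) → i = j) :
    ∑' i, (E i).elim 0 (fun q => (2⁻¹ : ℝ≥0∞) ^ q.1.length) ≤ 1 := by
  classical
  rw [ENNReal.tsum_eq_iSup_sum]
  refine iSup_le fun s => ?_
  let t := s.filter fun i => (E i).isSome
  let pr : ℕ → List Bool := fun i => (E i).elim [] Prod.fst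
  have hE : ∀ i ∈ t, ∃ x, E i = some (pr i, x) := fun i hi => by
    obtain ⟨q, hq⟩ := Option.isSome_iff_exists.1 (Finset.mem_filter.1 hi).2
    exact ⟨q.2, by simp [pr, hq]⟩
  have h1 : ∑ i ∈ s, (E i).elim 0 (fun q => (2⁻¹ : ℝ≥0∞) ^ q.1.length)
      = ∑ i ∈ t, (2⁻¹ : ℝ≥0∞) ^ (pr i).length := by
    rw [← Finset.sum_filter_add_sum_filter_not s (fun i => (E i).isSome)]
    rw [Finset.sum_eq_zero (s := s.filter fun i => ¬ (E i).isSome), add_zero]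
    · refine Finset.sum_congr rfl fun i hi => ?_
      obtain ⟨x, hx⟩ := hE i hi
      rw [hx]
      rfl
    · intro i hi
      have := (Finset.mem_filter.1 hi).2
      simp only [Bool.not_eq_true, Option.isSome_eq_false_iff, Option.isNone_iff_eq_none] at this
      simp [this]
  have h2 : ∑ i ∈ t, (2⁻¹ : ℝ≥0∞) ^ (pr i).length
      = ∑ p ∈ t.image pr, (2⁻¹ : ℝ≥0∞) ^ p.length := by
    rw [Finset.sum_image]
    intro i hi j hj hij
    obtain ⟨x, hx⟩ := hE i hi
    obtain ⟨y, hy⟩ := hE j hj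
    exact hinj i j (pr i) x y hx (by rw [hy, hij])
  have h3 : ∑ p ∈ t.image pr, (2⁻¹ : ℝ≥0∞) ^ p.length
      = ENNReal.ofReal (∑ p ∈ t.image pr, (1 / 2 : ℝ) ^ p.length) := by
    rw [ENNReal.ofReal_sum_of_nonneg fun _ _ => by positivity]
    refine Finset.sum_congr rfl fun p _ => ?_
    rw [ENNReal.ofReal_pow (by norm_num), one_div, ENNReal.ofReal_inv_of_pos (by norm_num)]
    simp
  rw [h1, h2, h3, ← ENNReal.ofReal_one]
  refine ENNReal.ofReal_le_ofReal (sum_two_pow_length_le_one ?_)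
  intro p hp q hq hpq
  obtain ⟨i, hi, rfl⟩ := Finset.mem_image.1 hp
  obtain ⟨j, hj, rfl⟩ := Finset.mem_image.1 hq
  obtain ⟨x, hx⟩ := hE i hi
  obtain ⟨y, hy⟩ := hE j hj
  exact hU.2 _ _ (Part.dom_iff_mem.2 ⟨x, hmem _ _ _ hx⟩) (Part.dom_iff_mem.2 ⟨y, hmem _ _ _ hy⟩) hpq

end Kraft

/-! ### The Kraft–Chaitin theorem -/

section KraftChaitin

/-- The number with big-endian binary digits `l`. -/
def bigEndian (l : List Bool) : ℕ := l.foldl (fun n b => 2 * n + b.toNat) 0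

theorem computable_bigEndian : Computable bigEndian := by
  refine (Primrec.list_foldl (f := fun l : List Bool => l) (g := fun _ => 0)
    (h := fun _ p => 2 * p.1 + p.2.toNat) Primrec.id (Primrec.const 0) ?_).to_comp
  exact Primrec.nat_add.comp (Primrec.nat_mul.comp (Primrec.const 2)
    (Primrec.fst.comp Primrec.snd)) ((Primrec.dom_bool Bool.toNat).comp
    (Primrec.snd.comp Primrec.snd))

theorem bigEndian_concat (l : List Bool) (b : Bool) :
    bigEndian (l ++ [b]) = 2 * bigEndian l + b.toNat := by
  simp [bigEndian]

/-- The extensions of `p` fill the dyadic interval of `p`, so comparable strings have nested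
intervals. -/
theorem bigEndian_append_bounds (p t : List Bool) :
    bigEndian p * 2 ^ t.length ≤ bigEndian (p ++ t) ∧
      bigEndian (p ++ t) < (bigEndian p + 1) * 2 ^ t.length := by
  induction t using List.reverseRecOn with
  | nil => simp
  | append_singleton t b ih =>
    rw [← List.append_assoc, bigEndian_concat, List.length_append, List.length_singleton, pow_succ]
    have := b.toNat_le
    constructor <;> nlinarith [ih.1, ih.2]

theorem exists_bigEndian_eq (R : ℕ) : ∀ c < 2 ^ R, ∃ p : List Bool, p.length = R ∧
    bigEndian p = c := by
  induction R with
  | zero => exact fun c hc => ⟨[], rfl, by simp at hc; simp [bigEndian, hc]⟩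
  | succ R ih =>
    intro c hc
    obtain ⟨p, hp, hv⟩ := ih (c / 2) (by rw [pow_succ] at hc; omega)
    refine ⟨p ++ [decide (c % 2 = 1)], by simp [hp], ?_⟩
    rw [bigEndian_concat, hv]
    by_cases h : c % 2 = 1 <;> simp [h] <;> omega

variable {U : List Bool →. List Bool}

/-- The Kraft–Chaitin theorem, for a sequence of requests with bounded partial weights. -/
theorem IsUniversalPrefixFreeMachine.exists_le_of_requests_real
    (hU : IsUniversalPrefixFreeMachine U) {req : ℕ → Option (ℕ × List Bool)}
    (hreq : Computable req) {C : ℕ}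
    (hC : ∀ n, ∑ i ∈ Finset.range n, (req i).elim 0 (fun q => (1 / 2 : ℝ) ^ q.1) ≤ 2 ^ C) :
    ∃ c, ∀ i r x, req i = some (r, x) → prefixComplexity U x ≤ r + c := by
  -- The exponent `e n` gives a common denominator 2^(e n) for the first n weights. Their sum `σ n`
  -- is then `T n` / 2^(e n), so it can be handled by integer arithmetic.
  let e : ℕ → ℕ := fun n => ∑ i ∈ Finset.range n, (req i).elim 0 Prod.fst
  let T : ℕ → ℕ := fun n => ∑ i ∈ Finset.range n, (req i).elim 0 fun q => 2 ^ (e n - q.1)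
  let σ : ℕ → ℝ := fun n => ∑ i ∈ Finset.range n, (req i).elim 0 fun q => (1 / 2 : ℝ) ^ q.1
  -- Request n receives the first dyadic interval of length 2^(-(r+1)) whose left end exceeds `σ n`.
  -- Halving the length guarantees that it ends by `σ (n + 1)`, so the intervals of different
  -- requests are disjoint and no free space has to be managed.
  let code : ℕ → ℕ → ℕ := fun n r => T n * 2 ^ (r + 1) / 2 ^ e n + 1
  have hTσ : ∀ n, (T n : ℝ) = σ n * 2 ^ e n := by
    intro n
    simp only [T, σ]
    push_cast
    rw [Finset.sum_mul]
    refine Finset.sum_congr rfl fun i hi => ?_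
    cases h : req i with
    | none => simp
    | some q =>
      have hle : q.1 ≤ e n := by
        have := Finset.single_le_sum (f := fun i => (req i).elim 0 Prod.fst)
          (fun _ _ => Nat.zero_le _) hi
        simpa [h] using this
      simp only [Option.elim_some]
      push_cast
      rw [pow_sub₀ _ two_ne_zero hle, one_div, inv_pow, mul_comm]
  have hσm : Monotone σ := monotone_nat_of_le_succ fun n => by
    simp only [σ, Finset.sum_range_succ]
    refine le_add_of_nonneg_right ?_
    cases req n with
    | none => exact le_rfl
    | some q => simp only [Option.elim_some]; positivity
  have hlow : ∀ n r, σ n < code n r * (1 / 2) ^ (r + 1) := by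
    intro n r
    have h1 : (T n * 2 ^ (r + 1) : ℕ) < 2 ^ e n * code n r := Nat.lt_mul_div_succ _ (by positivity)
    have h2 : σ n * 2 ^ e n * 2 ^ (r + 1) < 2 ^ e n * code n r := by
      rw [← hTσ]; exact_mod_cast h1
    have h3 : σ n * 2 ^ (r + 1) < code n r :=
      lt_of_mul_lt_mul_left (by linarith : (2 : ℝ) ^ e n * (σ n * 2 ^ (r + 1)) < _) (by positivity)
    rw [one_div, inv_pow, ← div_eq_mul_inv, lt_div_iff₀ (by positivity)]
    exact h3
  have hupp : ∀ n r x, req n = some (r, x) → (code n r + 1) * (1 / 2) ^ (r + 1) ≤ σ (n + 1) := by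
    intro n r x h
    have h1 : (T n * 2 ^ (r + 1) / 2 ^ e n) * 2 ^ e n ≤ T n * 2 ^ (r + 1) := Nat.div_mul_le_self _ _
    have h2 : ((code n r : ℝ) - 1) * 2 ^ e n ≤ σ n * 2 ^ (r + 1) * 2 ^ e n := by
      have : ((T n * 2 ^ (r + 1) / 2 ^ e n : ℕ) : ℝ) * 2 ^ e n ≤ T n * 2 ^ (r + 1) := by
        exact_mod_cast h1
      rw [hTσ] at this
      simp only [code, Nat.cast_add, Nat.cast_one, add_sub_cancel_right]
      linarith
    have h3 : (code n r : ℝ) - 1 ≤ σ n * 2 ^ (r + 1) := le_of_mul_le_mul_right h2 (by positivity)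
    have h4 : σ (n + 1) = σ n + (1 / 2) ^ r := by
      simp only [σ, Finset.sum_range_succ, h, Option.elim_some]
    rw [h4, one_div, inv_pow, inv_pow, ← div_eq_mul_inv, div_le_iff₀ (by positivity), add_mul,
      pow_succ]
    have : ((2 : ℝ) ^ r)⁻¹ * (2 ^ r * 2) = 2 := by field_simp
    rw [this]
    rw [pow_succ] at h3
    linarith
  -- The weights sum to at most 2^C rather than 1, so C further digits rescale the intervals into
  -- the unit interval.
  let tst : List Bool → ℕ → Option (List Bool) := fun p i => (req i).bind fun q =>
    bif decide (p.length = q.1 + 1 + C) && decide (bigEndian p = code i q.1)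
      then some q.2 else none
  have htst : ∀ p i x, tst p i = some x ↔ ∃ r, req i = some (r, x) ∧ p.length = r + 1 + C ∧
      bigEndian p = code i r := by
    intro p i x
    simp only [tst, Option.bind_eq_some_iff]
    constructor
    · rintro ⟨⟨r, y⟩, hq, h⟩
      by_cases hc : p.length = r + 1 + C ∧ bigEndian p = code i r
      · simp only [hc.1, hc.2, decide_true, Bool.and_self, cond_true, Option.some.injEq] at h
        exact ⟨r, h ▸ hq, hc⟩
      · have : (decide (p.length = r + 1 + C) && decide (bigEndian p = code i r)) = false := by
          simpa using hc
        simp [this] at h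
    · rintro ⟨r, hq, h1, h2⟩
      exact ⟨(r, x), hq, by simp [h1, h2]⟩
  have hcode : Computable fun p : ℕ × ℕ => code p.1 p.2 := by
    have he1 : Computable e := by
      refine Computable.sum_range (f := fun _ i => (req i).elim 0 Prod.fst) (h := fun n => n) ?_
        Computable.id
      exact Computable.option_elim_apply (f := fun p : ℕ × ℕ => req p.2) (c := fun _ => 0)
        (g := fun _ q => q.1) (by fun_prop) (by fun_prop) (by fun_prop)
    have hT : Computable T := by
      refine Computable.sum_range (f := fun n i => (req i).elim 0 fun q => 2 ^ (e n - q.1))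
        (h := fun n => n) ?_ Computable.id
      exact Computable.option_elim_apply (f := fun p : ℕ × ℕ => req p.2) (c := fun _ => 0)
        (g := fun p q => 2 ^ (e p.1 - q.1)) (by fun_prop) (by fun_prop) (by fun_prop)
    simp only [code]
    fun_prop
  have htc : Computable₂ tst := by
    have hbe := computable_bigEndian
    have hcc : Computable fun p : (List Bool × ℕ) × (ℕ × List Bool) => code p.1.2 p.2.1 :=
      hcode.comp (f := fun p : ℕ × ℕ => code p.1 p.2)
        (g := fun p : (List Bool × ℕ) × (ℕ × List Bool) => (p.1.2, p.2.1)) (by fun_prop)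
    have hn : Computable fun _ : (List Bool × ℕ) × (ℕ × List Bool) => (none : Option (List Bool)) :=
      Computable.const none
    exact Computable.option_bind (f := fun p : List Bool × ℕ => req p.2)
      (g := fun p q => bif decide (p.1.length = q.1 + 1 + C) && decide (bigEndian p.1 = code p.2 q.1)
        then some q.2 else none) (by fun_prop) (Computable.cond (by fun_prop) (by fun_prop) hn)
  -- Comparable programs have nested intervals, while different requests have disjoint ones. Hence
  -- the machine is prefix-free and each of its programs serves one request only.
  have hprefix : ∀ p q i j x y, tst p i = some x → tst q j = some y → p <+: q → i = j ∧ p = q := by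
    intro p q i j x y hp hq hpq
    obtain ⟨t, rfl⟩ := hpq
    obtain ⟨r, hi, hl, hv⟩ := (htst _ _ _).1 hp
    obtain ⟨r', hj, hl', hv'⟩ := (htst _ _ _).1 hq
    obtain ⟨b1, b2⟩ := bigEndian_append_bounds p t
    rw [hv, hv'] at b1 b2
    have hr : r' = r + t.length := by
      rw [List.length_append] at hl'; omega
    have hpow : (2 : ℝ) ^ t.length * (1 / 2) ^ (r' + 1) = (1 / 2) ^ (r + 1) := by
      rw [hr, one_div, show r + t.length + 1 = t.length + (r + 1) by ring, pow_add, ← mul_assoc,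
        ← mul_pow]
      norm_num
    have hpos : (0 : ℝ) < (1 / 2) ^ (r' + 1) := by positivity
    have hij : i = j := by
      rcases lt_trichotomy i j with h | h | h
      · exfalso
        have h1 := (hupp i r x hi).trans ((hσm h).trans (hlow j r').le)
        have h2 : (code j r' : ℝ) < (code i r + 1) * 2 ^ t.length := by exact_mod_cast b2
        have h3 := mul_lt_mul_of_pos_right h2 hpos
        rw [mul_assoc, hpow] at h3
        linarith
      · exact h
      · exfalso
        have h1 := ((hupp j r' y hj).trans (hσm h)).trans_lt (hlow i r)
        have h2 : (code i r : ℝ) * 2 ^ t.length ≤ code j r' := by exact_mod_cast b1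
        have h3 := mul_le_mul_of_nonneg_right h2 hpos.le
        rw [mul_assoc, hpow] at h3
        linarith
    subst hij
    refine ⟨rfl, ?_⟩
    rw [hi] at hj
    simp only [Option.some.injEq, Prod.mk.injEq] at hj
    have : t.length = 0 := by omega
    simp [List.length_eq_zero_iff.1 this]
  obtain ⟨c, hc⟩ := hU.exists_le_of_machine (M := fun p => Nat.rfindOpt (tst p))
    ⟨Partrec.rfindOpt htc, fun p q hp hq hpq => by
      obtain ⟨i, x, hi⟩ := Nat.rfindOpt_dom.1 hp
      obtain ⟨j, y, hj⟩ := Nat.rfindOpt_dom.1 hq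
      exact (hprefix p q i j x y hi hj hpq).2⟩
  refine ⟨1 + C + c, fun i r x hi => ?_⟩
  have hlt : code i r < 2 ^ (r + 1 + C) := by
    have h1 := (hupp i r x hi).trans (hC (i + 1))
    rw [one_div, inv_pow, ← div_eq_mul_inv, div_le_iff₀ (by positivity)] at h1
    have h2 : (code i r : ℝ) < 2 ^ (r + 1 + C) := by rw [pow_add _ (r + 1)]; linarith
    exact_mod_cast h2
  obtain ⟨p, hp, hv⟩ := exists_bigEndian_eq _ _ hlt
  have ht : tst p i = some x := (htst _ _ _).2 ⟨r, hi, hp, hv⟩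
  have hdom : (Nat.rfindOpt (tst p)).Dom := Nat.rfindOpt_dom.2 ⟨i, x, ht⟩
  obtain ⟨y, hy⟩ := Part.dom_iff_mem.1 hdom
  obtain ⟨j, hj⟩ := Nat.rfindOpt_spec hy
  obtain ⟨rfl, -⟩ := hprefix p p i j x y ht hj (List.prefix_refl p)
  rw [Option.mem_def, ht, Option.some.injEq] at hj
  subst hj
  have := hc p x hy
  omega

/-- The Kraft–Chaitin theorem, for a family of requests of finite total weight. -/
theorem IsUniversalPrefixFreeMachine.exists_le_of_requests (hU : IsUniversalPrefixFreeMachine U)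
    {ι : Type*} [Denumerable ι] {req : ι → Option (ℕ × List Bool)} (hreq : Computable req)
    (hsum : ∑' i, (req i).elim 0 (fun q => (2⁻¹ : ℝ≥0∞) ^ q.1) ≠ ∞) :
    ∃ c, ∀ i r x, req i = some (r, x) → prefixComplexity U x ≤ r + c := by
  rw [← (Denumerable.eqv ι).symm.tsum_eq] at hsum
  obtain ⟨C, hC⟩ := pow_unbounded_of_one_lt
    (∑' i, (req ((Denumerable.eqv ι).symm i)).elim 0 (fun q => (2⁻¹ : ℝ≥0∞) ^ q.1)).toReal
    (one_lt_two (α := ℝ))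
  have hbound : ∀ n, ∑ i ∈ Finset.range n, (req (Denumerable.ofNat ι i)).elim 0
      (fun q => (1 / 2 : ℝ) ^ q.1) ≤ 2 ^ C := by
    intro n
    refine le_trans ?_ hC.le
    have h := ENNReal.sum_le_tsum (f := fun i => (req ((Denumerable.eqv ι).symm i)).elim 0
      (fun q => (2⁻¹ : ℝ≥0∞) ^ q.1)) (Finset.range n)
    refine le_trans (le_of_eq ?_) (ENNReal.toReal_mono hsum h)
    have hfin : ∀ o : Option (ℕ × List Bool), o.elim 0 (fun q => (2⁻¹ : ℝ≥0∞) ^ q.1) ≠ ∞ := by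
      rintro (_ | q) <;> simp
    rw [ENNReal.toReal_sum fun i _ => hfin _]
    refine Finset.sum_congr rfl fun i _ => ?_
    change _ = ENNReal.toReal ((req (Denumerable.ofNat ι i)).elim 0 _)
    cases req (Denumerable.ofNat ι i) <;> simp
  obtain ⟨c, hc⟩ := hU.exists_le_of_requests_real (hreq.comp (Computable.ofNat ι)) hbound
  exact ⟨c, fun i r x hi => hc (Encodable.encode i) r x (by simpa using hi)⟩

end KraftChaitin

/-! ### The coding theorem and the countability of the K-trivial sequences -/

section Counting

theorem ENNReal.inv_two_pow_mul_two_pow (n : ℕ) : (2⁻¹ : ℝ≥0∞) ^ n * 2 ^ n = 1 := by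
  rw [← mul_pow, ENNReal.inv_mul_cancel two_ne_zero ENNReal.ofNat_ne_top, one_pow]

theorem ENNReal.inv_two_pow_pos (n : ℕ) : 0 < (2⁻¹ : ℝ≥0∞) ^ n :=
  ENNReal.pow_pos (by simp) n

theorem tsum_le_of_subsingleton_support {f : ℕ → ℝ≥0∞} {c : ℝ≥0∞} (hc : ∀ i, f i ≤ c)
    (h1 : ∀ i j, f i ≠ 0 → f j ≠ 0 → i = j) : ∑' i, f i ≤ c := by
  by_cases h : ∃ i, f i ≠ 0
  · obtain ⟨i, hi⟩ := h
    rw [tsum_eq_single i fun j hj => by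
      by_contra h0
      exact hj (h1 j i h0 hi)]
    exact hc i
  · push Not at h
    simp [h]

/-- The terms form a geometric tail starting at the least r with 2^(-r) ≤ M. -/
theorem tsum_inv_two_pow_of_le (M : ℝ≥0∞) :
    ∑' r : ℕ, (if (2⁻¹ : ℝ≥0∞) ^ r ≤ M then (2⁻¹ : ℝ≥0∞) ^ r else 0) ≤ 2 * M := by
  classical
  by_cases h : ∃ r : ℕ, (2⁻¹ : ℝ≥0∞) ^ r ≤ M
  · have hr := Nat.find_spec h
    set r₀ := Nat.find h
    rw [← Summable.sum_add_tsum_nat_add' (k := r₀) ENNReal.summable, Finset.sum_eq_zero, zero_add]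
    · calc _ ≤ ∑' r : ℕ, (2⁻¹ : ℝ≥0∞) ^ r * 2⁻¹ ^ r₀ := by
            refine ENNReal.tsum_le_tsum fun r => ?_
            rw [← pow_add]
            split_ifs
            · exact le_rfl
            · exact zero_le
        _ = 2 * 2⁻¹ ^ r₀ := by
            rw [ENNReal.tsum_mul_right, ENNReal.tsum_geometric, ENNReal.one_sub_inv_two, inv_inv]
        _ ≤ 2 * M := by gcongr
    · intro r hr'
      rw [if_neg (Nat.find_min h (Finset.mem_range.1 hr'))]
  · push Not at h
    simp [fun r => not_le.2 (h r)]

variable {U : List Bool →. List Bool}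

/-- The total weight of the descriptions of strings of length `n` in an enumeration of a
machine. -/
noncomputable def lengthMass (E : ℕ → Option (List Bool × List Bool)) (n j : ℕ) : ℝ≥0∞ :=
  (E j).elim 0 fun q => if q.2.length = n then 2⁻¹ ^ q.1.length else 0

theorem tsum_tsum_lengthMass (E : ℕ → Option (List Bool × List Bool)) :
    ∑' n, ∑' j, lengthMass E n j =
      ∑' j, (E j).elim 0 (fun q => (2⁻¹ : ℝ≥0∞) ^ q.1.length) := by
  rw [ENNReal.tsum_comm]
  refine tsum_congr fun j => ?_
  unfold lengthMass
  cases h : E j with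
  | none => simp
  | some q =>
    simp only [Option.elim_some]
    rw [tsum_eq_single q.2.length fun n hn => if_neg hn.symm, if_pos rfl]

/-- The coding theorem for the semimeasure that a machine induces on lengths. -/
theorem IsUniversalPrefixFreeMachine.exists_coding_bound (hU : IsUniversalPrefixFreeMachine U)
    {E : ℕ → Option (List Bool × List Bool)} (hE : Computable E)
    (hsum : ∑' j, (E j).elim 0 (fun q => (2⁻¹ : ℝ≥0∞) ^ q.1.length) ≤ 1) :
    ∃ c, ∀ n r : ℕ, (2⁻¹ : ℝ≥0∞) ^ r < ∑' j, lengthMass E n j →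
      natPrefixComplexity U n ≤ r + c := by
  let m : ℕ → ℕ → ℝ≥0∞ := fun n i => ∑ j ∈ Finset.range i, lengthMass E n j
  let e : ℕ → ℕ := fun i => ∑ j ∈ Finset.range i, (E j).elim 0 fun q => q.1.length
  -- This is the numerator of `m n i` over 2^(e i), which makes comparisons with powers of two
  -- decidable.
  let T : ℕ → ℕ → ℕ := fun n i => ∑ j ∈ Finset.range i, (E j).elim 0 fun q =>
    bif decide (q.2.length = n) then 2 ^ (e i - q.1.length) else 0
  have hmm : ∀ n, Monotone (m n) := fun n =>
    (Finset.sum_mono_set _).comp Finset.range_mono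
  have hmT : ∀ n i, (T n i : ℝ≥0∞) = m n i * 2 ^ e i := by
    intro n i
    simp only [T, m]
    push_cast
    rw [Finset.sum_mul]
    refine Finset.sum_congr rfl fun j hj => ?_
    unfold lengthMass
    cases h : E j with
    | none => simp
    | some q =>
      have hle : q.1.length ≤ e i := by
        have := Finset.single_le_sum (f := fun j => (E j).elim 0 fun q => q.1.length)
          (fun _ _ => Nat.zero_le _) hj
        simpa [h] using this
      by_cases hn : q.2.length = n
      · simp only [Option.elim_some, hn, decide_true, cond_true, if_true]
        obtain ⟨d, hd⟩ := Nat.exists_eq_add_of_le hle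
        rw [hd, Nat.add_sub_cancel_left, pow_add, ← mul_assoc, ENNReal.inv_two_pow_mul_two_pow]
        simp
      · simp [hn]
  have hlt : ∀ n i r, T n i * 2 ^ r < 2 ^ e i ↔ m n i < 2⁻¹ ^ r := by
    intro n i r
    have h1 : T n i * 2 ^ r < 2 ^ e i ↔ (T n i : ℝ≥0∞) * 2 ^ r < 2 ^ e i := by exact_mod_cast Iff.rfl
    have h2 : (2 : ℝ≥0∞) ^ e i = 2⁻¹ ^ r * (2 ^ e i * 2 ^ r) := by
      rw [mul_left_comm, ENNReal.inv_two_pow_mul_two_pow, mul_one]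
    have h3 : (2 : ℝ≥0∞) ^ e i * 2 ^ r ≠ 0 := by simp
    have h4 : (2 : ℝ≥0∞) ^ e i * 2 ^ r ≠ ∞ := by finiteness
    have h5 := ENNReal.mul_lt_mul_iff_left h3 h4 (a := m n i) (b := 2⁻¹ ^ r)
    rw [← h2] at h5
    rw [h1, hmT, mul_assoc, h5]
  -- A description of n of length r is requested at the unique stage, if any, at which the
  -- enumerated mass reaches 2^(-r). The lengths requested for one n thus have total weight at most
  -- twice its mass.
  let req : ℕ × ℕ × ℕ → Option (ℕ × List Bool) := fun a =>
    bif decide (T a.1 a.2.2 * 2 ^ a.2.1 < 2 ^ e a.2.2) &&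
      !decide (T a.1 (a.2.2 + 1) * 2 ^ a.2.1 < 2 ^ e (a.2.2 + 1))
    then some (a.2.1, a.1.bits) else none
  have hreq : ∀ n r i, req (n, r, i) = if m n i < 2⁻¹ ^ r ∧ 2⁻¹ ^ r ≤ m n (i + 1)
      then some (r, n.bits) else none := by
    intro n r i
    simp only [req, Bool.cond_eq_ite, Bool.and_eq_true, decide_eq_true_eq, Bool.not_eq_true',
      decide_eq_false_iff_not, hlt, not_lt]
  have hcomp : Computable req := by
    have he : Computable e := by
      refine Computable.sum_range (f := fun _ j => (E j).elim 0 fun q => q.1.length)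
        (h := fun i => i) ?_ Computable.id
      exact Computable.option_elim_apply (f := fun p : ℕ × ℕ => E p.2) (c := fun _ => 0)
        (g := fun _ q => q.1.length) (by fun_prop) (by fun_prop) (by fun_prop)
    have hT : Computable fun a : ℕ × ℕ => T a.1 a.2 := by
      refine Computable.sum_range (f := fun (a : ℕ × ℕ) j => (E j).elim 0 fun q =>
        bif decide (q.2.length = a.1) then 2 ^ (e a.2 - q.1.length) else 0)
        (h := fun a => a.2) ?_ (by fun_prop)
      exact Computable.option_elim_apply (f := fun p : (ℕ × ℕ) × ℕ => E p.2) (c := fun _ => 0)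
        (g := fun p q => bif decide (q.2.length = p.1.1) then 2 ^ (e p.1.2 - q.1.length) else 0)
        (by fun_prop) (by fun_prop) (by fun_prop)
    have hT0 : Computable fun a : ℕ × ℕ × ℕ => T a.1 a.2.2 :=
      hT.comp (f := fun a : ℕ × ℕ => T a.1 a.2)
        (g := fun a : ℕ × ℕ × ℕ => (a.1, a.2.2)) (by fun_prop)
    have hT1 : Computable fun a : ℕ × ℕ × ℕ => T a.1 (a.2.2 + 1) :=
      hT.comp (f := fun a : ℕ × ℕ => T a.1 a.2)
        (g := fun a : ℕ × ℕ × ℕ => (a.1, a.2.2 + 1)) (by fun_prop)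
    clear_value T e
    have hn : Computable fun _ : ℕ × ℕ × ℕ => (none : Option (ℕ × List Bool)) :=
      Computable.const none
    exact Computable.cond (by fun_prop) (by fun_prop) hn
  clear_value req
  have hwt : ∑' a, (req a).elim 0 (fun q => (2⁻¹ : ℝ≥0∞) ^ q.1) ≠ ∞ := by
    suffices h : ∑' a, (req a).elim 0 (fun q => (2⁻¹ : ℝ≥0∞) ^ q.1) ≤ 2 from
      ne_top_of_le_ne_top ENNReal.ofNat_ne_top h
    have hn : ∀ n, ∑' b : ℕ × ℕ, (req (n, b)).elim 0 (fun q => (2⁻¹ : ℝ≥0∞) ^ q.1)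
        ≤ 2 * ∑' j, lengthMass E n j := by
          intro n
          rw [ENNReal.tsum_prod']
          refine le_trans (ENNReal.tsum_le_tsum fun r => ?_)
            (tsum_inv_two_pow_of_le (∑' j, lengthMass E n j))
          have hle : ∀ i, m n i ≤ ∑' j, lengthMass E n j := fun i => ENNReal.sum_le_tsum _
          have hite : ∀ i, (req (n, r, i)).elim 0 (fun q => (2⁻¹ : ℝ≥0∞) ^ q.1) =
              if m n i < 2⁻¹ ^ r ∧ 2⁻¹ ^ r ≤ m n (i + 1) then 2⁻¹ ^ r else 0 := by
            intro i
            rw [hreq]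
            split_ifs <;> rfl
          refine tsum_le_of_subsingleton_support (fun i => ?_) fun i j hi hj => ?_
          · rw [hite]
            split_ifs with h1 h2 h2
            · exact le_rfl
            · exact absurd (h1.2.trans (hle _)) h2
            · exact zero_le
            · exact le_rfl
          · rw [hite] at hi hj
            simp only [ne_eq, ite_eq_right_iff, not_forall] at hi hj
            obtain ⟨⟨hi1, hi2⟩, -⟩ := hi
            obtain ⟨⟨hj1, hj2⟩, -⟩ := hj
            by_contra hne
            rcases lt_or_gt_of_ne hne with h | h
            · exact absurd (hi2.trans (hmm n h)) (not_le.2 hj1)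
            · exact absurd (hj2.trans (hmm n h)) (not_le.2 hi1)
    rw [ENNReal.tsum_prod']
    calc _ ≤ ∑' n, 2 * ∑' j, lengthMass E n j := ENNReal.tsum_le_tsum hn
      _ = 2 * ∑' j, (E j).elim 0 (fun q => (2⁻¹ : ℝ≥0∞) ^ q.1.length) := by
          rw [ENNReal.tsum_mul_left, tsum_tsum_lengthMass]
      _ ≤ 2 := mul_le_of_le_one_right' hsum
  obtain ⟨c, hc⟩ := hU.exists_le_of_requests hcomp hwt
  refine ⟨c, fun n r h => ?_⟩
  classical
  -- The strict inequality ensures that the threshold is reached at a finite stage.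
  have hex : ∃ i, (2⁻¹ : ℝ≥0∞) ^ r ≤ m n i := by
    rw [ENNReal.tsum_eq_iSup_nat] at h
    obtain ⟨i, hi⟩ := lt_iSup_iff.1 h
    exact ⟨i, hi.le⟩
  obtain ⟨i, hi⟩ : ∃ i, Nat.find hex = i + 1 := by
    refine Nat.exists_eq_succ_of_ne_zero fun h0 => ?_
    have := Nat.find_spec hex
    rw [h0] at this
    exact absurd this (not_le.2 (by
      simp only [m, Finset.sum_range_zero]
      exact ENNReal.inv_two_pow_pos r))
  refine hc (n, r, i) r n.bits ?_
  rw [hreq, if_pos ⟨not_le.1 (Nat.find_min hex (by omega)), by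
    rw [← hi]; exact Nat.find_spec hex⟩]

/-- There are `O(2 ^ b)` strings of length `n` whose complexity is at most `K(n) + b`. -/
theorem IsUniversalPrefixFreeMachine.exists_card_le (hU : IsUniversalPrefixFreeMachine U) :
    ∃ c, ∀ (n b : ℕ) (S : Finset (List Bool)), (∀ x ∈ S, x.length = n ∧
      prefixComplexity U x ≤ natPrefixComplexity U n + b) → S.card ≤ 2 ^ (b + c) := by
  obtain ⟨E, hE, hmem, hex, hinj⟩ := exists_enumeration_of_partrec hU.1.1
  have hsum := tsum_enumeration_le_one hU.1 hmem hinj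
  obtain ⟨c, hc⟩ := hU.exists_coding_bound hE hsum
  refine ⟨c + 1, fun n b S hS => ?_⟩
  have hidx : ∀ x, ∃ i p, E i = some (p, x) ∧ p.length = prefixComplexity U x := fun x => by
    obtain ⟨p, hp, hl⟩ := hU.exists_length_eq x
    obtain ⟨i, hi⟩ := hex p x hp
    exact ⟨i, p, hi, hl⟩
  choose idx pr hi hl using hidx
  set K := natPrefixComplexity U n
  -- Different strings have different shortest descriptions, each of weight at least 2^(-(K+b)).
  have hmass : (S.card : ℝ≥0∞) * 2⁻¹ ^ (K + b) ≤ ∑' j, lengthMass E n j := by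
    have h1 : (S.card : ℝ≥0∞) * 2⁻¹ ^ (K + b) ≤ ∑ x ∈ S, lengthMass E n (idx x) := by
      rw [← nsmul_eq_mul]
      refine Finset.card_nsmul_le_sum _ _ _ fun x hx => ?_
      simp only [lengthMass, hi x, Option.elim_some, (hS x hx).1, if_true, hl x]
      exact pow_le_pow_right_of_le_one' (by simp) (hS x hx).2
    refine h1.trans ?_
    have hinj' : Set.InjOn idx S := fun x _ y _ hxy => by
      have h1 := hi x
      rw [hxy, hi y] at h1
      simp only [Option.some.injEq, Prod.mk.injEq] at h1
      exact h1.2.symm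
    rw [← Finset.sum_image (f := lengthMass E n) hinj']
    exact ENNReal.sum_le_tsum _
  by_contra! hcard
  -- For K ≥ c + 1, too many strings would push the mass above 2^(-(K-c-1)), and the coding theorem
  -- would give K ≤ K - 1. For K ≤ c, the bound by total mass 1 is already enough.
  rcases le_or_gt (c + 1) K with hK | hK
  · obtain ⟨d, hd⟩ := Nat.exists_eq_add_of_le hK
    have : (2⁻¹ : ℝ≥0∞) ^ d < ∑' j, lengthMass E n j := by
      refine lt_of_lt_of_le ?_ hmass
      have h2 : (2⁻¹ : ℝ≥0∞) ^ d = 2 ^ (b + (c + 1)) * 2⁻¹ ^ (K + b) := by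
        rw [hd, show c + 1 + d + b = (b + (c + 1)) + d by ring, pow_add _ _ d, ← mul_assoc,
          mul_comm (2 ^ _) (2⁻¹ ^ _), ENNReal.inv_two_pow_mul_two_pow, one_mul]
      rw [h2, ENNReal.mul_lt_mul_iff_left (ENNReal.inv_two_pow_pos _).ne'
        (ENNReal.pow_ne_top (by simp))]
      exact_mod_cast hcard
    have := hc n d this
    omega
  · have h1 : (S.card : ℝ≥0∞) * 2⁻¹ ^ (K + b) ≤ 1 := hmass.trans
      (((ENNReal.le_tsum n).trans (tsum_tsum_lengthMass E).le).trans hsum)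
    have h2 : (S.card : ℝ≥0∞) ≤ 2 ^ (K + b) := by
      have := mul_le_mul_left h1 (2 ^ (K + b))
      rwa [mul_assoc, ENNReal.inv_two_pow_mul_two_pow, mul_one, one_mul] at this
    have h3 : S.card ≤ 2 ^ (K + b) := by exact_mod_cast h2
    exact absurd (hcard.trans_le h3) (not_lt.2 (Nat.pow_le_pow_right (by norm_num) (by omega)))

theorem initialSegment_length (A : ℕ → Bool) (n : ℕ) : (initialSegment A n).length = n := by
  simp [initialSegment]

theorem eq_of_initialSegment_eq {A B : ℕ → Bool} {n i : ℕ}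
    (h : initialSegment A n = initialSegment B n) (hi : i < n) : A i = B i :=
  (List.map_inj_left.1 h) i (List.mem_range.2 hi)

theorem exists_injOn_initialSegment (F : Finset (ℕ → Bool)) :
    ∃ n, Set.InjOn (fun A => initialSegment A n) (F : Set (ℕ → Bool)) := by
  have : ∀ P : (ℕ → Bool) × (ℕ → Bool), ∃ i, P.1 i = P.2 i → P.1 = P.2 := fun P => by
    by_cases h : P.1 = P.2
    · exact ⟨0, fun _ => h⟩
    · obtain ⟨i, hi⟩ := Function.ne_iff.1 h
      exact ⟨i, fun h' => absurd h' hi⟩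
  choose d hd using this
  refine ⟨(F ×ˢ F).sup d + 1, fun A hA B hB hAB => hd (A, B) (eq_of_initialSegment_eq hAB ?_)⟩
  exact Nat.lt_succ_of_le (Finset.le_sup (f := d) (Finset.mk_mem_product hA hB))

/-- For a fixed constant b, any finite set of such sequences has pairwise distinct prefixes of some
common length, so its size is bounded by `exists_card_le`. -/
theorem IsUniversalPrefixFreeMachine.countable_setOf_isKTrivial
    (hU : IsUniversalPrefixFreeMachine U) : {A : ℕ → Bool | IsKTrivial U A}.Countable := by
  obtain ⟨c, hc⟩ := hU.exists_card_le
  have : {A : ℕ → Bool | IsKTrivial U A} = ⋃ b : ℕ, {A | ∀ n,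
      prefixComplexity U (initialSegment A n) ≤ natPrefixComplexity U n + b} := by
    ext A
    simp [IsKTrivial]
  rw [this]
  refine Set.countable_iUnion fun b => Set.Finite.countable ?_
  by_contra hinf
  obtain ⟨F, hF, hcard⟩ := Set.Infinite.exists_subset_card_eq hinf (2 ^ (b + c) + 1)
  obtain ⟨n, hn⟩ := exists_injOn_initialSegment F
  have := hc n b (F.image fun A => initialSegment A n) fun x hx => by
    obtain ⟨A, hA, rfl⟩ := Finset.mem_image.1 hx
    exact ⟨initialSegment_length A n, hF hA n⟩
  rw [Finset.card_image_of_injOn hn, hcard] at this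
  omega

end Counting

/-! ### The restart process and its accounting -/

theorem exists_eq_of_antitone {f : ℕ → ℕ} (hf : Antitone f) : ∃ s, ∀ u ≥ s, f u = f s := by
  obtain ⟨s, hs⟩ : ∃ s, ∀ u, f s ≤ f u := ⟨Function.argmin f, fun u => Function.argmin_le f u⟩
  exact ⟨s, fun u hu => le_antisymm (hf hu) (hs u)⟩

section Markers

variable (G H : ℕ → ℕ → ℕ)

/-- The weight `∑_{n < s} 2 ^ (-G n s)` at stage `s`. -/
noncomputable def alpha (s : ℕ) : ℝ := ∑ n ∈ Finset.range s, (1 / 2 : ℝ) ^ G n s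

/-- The weight at stage `s` that `H` confirms up to the factor `2 ^ (2 * k)`. -/
noncomputable def beta (k s : ℕ) : ℝ :=
  ∑ n ∈ Finset.range s, (1 / 2 : ℝ) ^ max (H n s) (G n s - 2 * k)

/-- A common bound for the exponents at the stages up to `s`. -/
def expBound (s : ℕ) : ℕ := ∑ n ∈ Finset.range s, (G n 0 + H n 0)

/-- The numerator of `alpha` over the denominator `2 ^ E`. -/
def alphaNum (s E : ℕ) : ℕ := ∑ n ∈ Finset.range s, 2 ^ (E - G n s)

/-- The numerator of `beta` over the denominator `2 ^ E`. -/
def betaNum (k s E : ℕ) : ℕ := ∑ n ∈ Finset.range s, 2 ^ (E - max (H n s) (G n s - 2 * k))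

/-- By stage `s + 1`, the weight has grown since stage `q.2` by at least `2 ^ (-k)` times the
growth of the confirmed weight between the stages `q.1` and `q.2`. -/
def exhausted (k s : ℕ) (q : ℕ × ℕ) : Bool :=
  decide (alphaNum G q.2 (expBound G H (s + 1)) * 2 ^ k + betaNum G H k q.2 (expBound G H (s + 1))
    ≤ alphaNum G (s + 1) (expBound G H (s + 1)) * 2 ^ k + betaNum G H k q.1 (expBound G H (s + 1)))

/-- The last but one and the last restart, at stage `s`, of the process with parameter `k`. -/
def restarts (k s : ℕ) : ℕ × ℕ :=
  Nat.rec (0, 0) (fun s q => bif exhausted G H k s q then (q.2, s + 1) else q) s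

theorem restarts_succ (k s : ℕ) : restarts G H k (s + 1) =
    bif exhausted G H k s (restarts G H k s) then ((restarts G H k s).2, s + 1)
    else restarts G H k s := rfl

theorem restarts_le (k s : ℕ) :
    (restarts G H k s).1 ≤ (restarts G H k s).2 ∧ (restarts G H k s).2 ≤ s := by
  induction s with
  | zero => exact ⟨le_rfl, le_rfl⟩
  | succ s ih =>
    rw [restarts_succ]
    cases exhausted G H k s (restarts G H k s)
    · exact ⟨ih.1, ih.2.trans s.le_succ⟩
    · exact ⟨ih.2.trans s.le_succ, le_rfl⟩

theorem restarts_snd_mono (k : ℕ) : Monotone fun s => (restarts G H k s).2 :=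
  monotone_nat_of_le_succ fun s => by
    rw [restarts_succ]
    cases exhausted G H k s (restarts G H k s)
    · exact le_rfl
    · exact (restarts_le G H k s).2.trans s.le_succ

/-- The time of the last restart is also a stage at which it is already recorded. A limiting value
therefore bounds its own settling time. -/
theorem restarts_snd_restarts_snd (k s : ℕ) :
    (restarts G H k (restarts G H k s).2).2 = (restarts G H k s).2 := by
  induction s with
  | zero => rfl
  | succ s ih =>
    cases h : exhausted G H k s (restarts G H k s)
    · have : restarts G H k (s + 1) = restarts G H k s := by rw [restarts_succ, h]; rfl
      rw [this, ih]
    · have : (restarts G H k (s + 1)).2 = s + 1 := by rw [restarts_succ, h]; rfl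
      rw [this, this]

variable {G H}

theorem half_pow_le {a b : ℕ} (h : a ≤ b) : (1 / 2 : ℝ) ^ b ≤ (1 / 2) ^ a :=
  pow_le_pow_of_le_one (by norm_num) (by norm_num) h

theorem natCast_two_pow_sub {a E : ℕ} (h : a ≤ E) :
    ((2 ^ (E - a) : ℕ) : ℝ) = (1 / 2) ^ a * 2 ^ E := by
  push_cast
  rw [pow_sub₀ _ two_ne_zero h, one_div, inv_pow, mul_comm]

theorem le_expBound (hG : ∀ n, Antitone (G n)) (hH : ∀ n, Antitone (H n))
    {n s t : ℕ} (h : n < s) (k : ℕ) :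
    G n t ≤ expBound G H s ∧ max (H n t) (G n t - 2 * k) ≤ expBound G H s := by
  have h1 : G n 0 + H n 0 ≤ expBound G H s := Finset.single_le_sum
    (f := fun n => G n 0 + H n 0) (fun _ _ => Nat.zero_le _) (Finset.mem_range.2 h)
  have h2 := hG n t.zero_le
  have h3 := hH n t.zero_le
  omega

theorem alphaNum_eq (hG : ∀ n, Antitone (G n)) (hH : ∀ n, Antitone (H n))
    {t s : ℕ} (h : t ≤ s) :
    (alphaNum G t (expBound G H s) : ℝ) = alpha G t * 2 ^ expBound G H s := by
  unfold alphaNum alpha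
  rw [Nat.cast_sum, Finset.sum_mul]
  exact Finset.sum_congr rfl fun n hn => natCast_two_pow_sub
    (le_expBound hG hH ((Finset.mem_range.1 hn).trans_le h) 0).1

theorem betaNum_eq (hG : ∀ n, Antitone (G n)) (hH : ∀ n, Antitone (H n))
    {t s : ℕ} (k : ℕ) (h : t ≤ s) :
    (betaNum G H k t (expBound G H s) : ℝ) = beta G H k t * 2 ^ expBound G H s := by
  unfold betaNum beta
  rw [Nat.cast_sum, Finset.sum_mul]
  exact Finset.sum_congr rfl fun n hn => natCast_two_pow_sub
    (le_expBound hG hH ((Finset.mem_range.1 hn).trans_le h) k).2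

/-- The integer test is the real inequality multiplied by the common denominator. -/
theorem exhausted_restarts_iff (hG : ∀ n, Antitone (G n)) (hH : ∀ n, Antitone (H n))
    (k s : ℕ) : exhausted G H k s (restarts G H k s) = true ↔
    alpha G (restarts G H k s).2 * 2 ^ k + beta G H k (restarts G H k s).2 ≤
      alpha G (s + 1) * 2 ^ k + beta G H k (restarts G H k s).1 := by
  obtain ⟨h1, h2⟩ := restarts_le G H k s
  rw [exhausted, decide_eq_true_iff, ← @Nat.cast_le ℝ]
  push_cast
  rw [alphaNum_eq hG hH (by omega), alphaNum_eq hG hH le_rfl, betaNum_eq hG hH _ (by omega),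
    betaNum_eq hG hH _ (by omega)]
  have hpos : (0 : ℝ) < 2 ^ expBound G H (s + 1) := by positivity
  constructor <;> intro h
  · exact le_of_mul_le_mul_right (by linarith) hpos
  · have := mul_le_mul_of_nonneg_right h hpos.le
    linarith

theorem alpha_lt_succ (hG : ∀ n, Antitone (G n))
    (s : ℕ) : alpha G s < alpha G (s + 1) := by
  unfold alpha
  rw [Finset.sum_range_succ]
  have h1 : ∑ n ∈ Finset.range s, (1 / 2 : ℝ) ^ G n s ≤
      ∑ n ∈ Finset.range s, (1 / 2 : ℝ) ^ G n (s + 1) :=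
    Finset.sum_le_sum fun n _ => half_pow_le (hG n s.le_succ)
  have h2 : (0 : ℝ) < (1 / 2) ^ G s (s + 1) := by positivity
  linarith

theorem alpha_mono (hG : ∀ n, Antitone (G n)) :
    Monotone (alpha G) :=
  monotone_nat_of_le_succ fun s => (alpha_lt_succ hG s).le

theorem beta_mono (hG : ∀ n, Antitone (G n)) (hH : ∀ n, Antitone (H n))
    (k : ℕ) : Monotone (beta G H k) := monotone_nat_of_le_succ fun s => by
  unfold beta
  rw [Finset.sum_range_succ]
  have h1 : ∑ n ∈ Finset.range s, (1 / 2 : ℝ) ^ max (H n s) (G n s - 2 * k) ≤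
      ∑ n ∈ Finset.range s, (1 / 2 : ℝ) ^ max (H n (s + 1)) (G n (s + 1) - 2 * k) :=
    Finset.sum_le_sum fun n _ => half_pow_le
      (max_le_max (hH n s.le_succ) (Nat.sub_le_sub_right (hG n s.le_succ) _))
  have h2 : (0 : ℝ) ≤ (1 / 2) ^ max (H s (s + 1)) (G s (s + 1) - 2 * k) := by positivity
  linarith

theorem beta_le_one (hsum : ∀ s, ∑ n ∈ Finset.range s, (1 / 2 : ℝ) ^ H n s ≤ 1) (k s : ℕ) :
    beta G H k s ≤ 1 :=
  (Finset.sum_le_sum fun _ _ => half_pow_le (le_max_left _ _)).trans (hsum s)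

/-- The growth of the weight at the stages without a restart is at most `2 ^ (-k)`. -/
theorem sum_growth_le (hG : ∀ n, Antitone (G n)) (hH : ∀ n, Antitone (H n))
    (hsum : ∀ s, ∑ n ∈ Finset.range s, (1 / 2 : ℝ) ^ H n s ≤ 1) (k S : ℕ) :
    ∑ s ∈ Finset.range S, (if exhausted G H k s (restarts G H k s) then 0
      else alpha G (s + 1) - alpha G s) ≤ (1 / 2) ^ k := by
  -- Write (q₁, q₂) for the last two restarts. The current period has spent at most its allowance
  -- `beta` q₂ - `beta` q₁, and all earlier periods together at most `beta` q₁, everything scaled by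
  -- 2^k. At a restart q₂ takes the place of q₁, and the restarting stage itself is not charged.
  have key : ∑ s ∈ Finset.range S, (if exhausted G H k s (restarts G H k s) then 0
      else alpha G (s + 1) - alpha G s) * 2 ^ k ≤ beta G H k (restarts G H k S).1 +
        (alpha G S - alpha G (restarts G H k S).2) * 2 ^ k ∧
      (alpha G S - alpha G (restarts G H k S).2) * 2 ^ k ≤
        beta G H k (restarts G H k S).2 - beta G H k (restarts G H k S).1 := by
    induction S with
    | zero => simp [restarts, beta]
    | succ S ih =>
      obtain ⟨ih1, ih2⟩ := ih
      rw [Finset.sum_range_succ, restarts_succ]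
      have hiff := exhausted_restarts_iff hG hH k S
      by_cases h : exhausted G H k S (restarts G H k S) = true
      · rw [h, cond_true, if_pos rfl, zero_mul, add_zero, sub_self, zero_mul, add_zero]
        exact ⟨by linarith, sub_nonneg.2 (beta_mono hG hH k
          ((restarts_le G H k S).2.trans S.le_succ))⟩
      · have h' := not_le.1 (mt hiff.2 h)
        rw [Bool.not_eq_true] at h
        rw [h, cond_false, if_neg (by simp)]
        constructor <;> linarith
  rw [← Finset.sum_mul] at key
  have h1 : (∑ s ∈ Finset.range S, (if exhausted G H k s (restarts G H k s) then 0
      else alpha G (s + 1) - alpha G s)) * 2 ^ k ≤ 1 := by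
    linarith [key.1, key.2, beta_le_one (G := G) hsum k (restarts G H k S).2]
  rw [one_div, inv_pow, ← one_div]
  rwa [le_div_iff₀ (by positivity)]

/-- For n < N the exponents have settled by stage `s₀`, so `alpha` gains nothing there. Every other
n is eventually confirmed and then counts in `beta` with at least 2^(2k) times its weight in
`alpha`. -/
theorem growth_le_beta_growth (hG : ∀ n, Antitone (G n)) (hH : ∀ n, Antitone (H n))
    {k N : ℕ} (hN : ∀ n ≥ N, ∃ s, ∀ u ≥ s, H n u + 2 * k ≤ G n u) :
    ∃ s₀, ∀ s ≥ s₀, ∀ u ≥ s, ∃ v,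
      (alpha G u - alpha G s) * 2 ^ (2 * k) ≤ beta G H k v - beta G H k s := by
  have hlim := fun n => exists_eq_of_antitone (hG n)
  choose lim hlim using hlim
  choose! conf hconf using hN
  refine ⟨N + (Finset.range N).sup lim, fun s hs u hu => ?_⟩
  have hGs : ∀ n < N, G n u = G n s := fun n hn => by
    have hl : lim n ≤ s := (Finset.le_sup (Finset.mem_range.2 hn)).trans (by omega)
    rw [hlim n u (hl.trans hu), hlim n s hl]
  -- By this stage every n in [N, u) has been confirmed.
  let v := u + (Finset.range u).sup conf
  have huv : u ≤ v := Nat.le_add_right _ _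
  refine ⟨v, ?_⟩
  have hv : ∀ n ≥ N, n < u → (1 / 2 : ℝ) ^ G n u * 2 ^ (2 * k) ≤
      (1 / 2) ^ max (H n v) (G n v - 2 * k) := by
    intro n hn hnu
    have hc := hconf n hn v ((Finset.le_sup (Finset.mem_range.2 hnu)).trans (Nat.le_add_left _ _))
    rw [max_eq_right (by omega)]
    obtain ⟨d, hd⟩ := Nat.exists_eq_add_of_le (show 2 * k ≤ G n u by
      have := hG n huv; omega)
    have h1 : (1 / 2 : ℝ) ^ G n u * 2 ^ (2 * k) = (1 / 2) ^ d := by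
      rw [hd, pow_add, mul_right_comm, ← mul_pow]
      norm_num
    rw [h1]
    exact half_pow_le (by have := hG n huv; omega)
  -- The cap in `beta` matters here: the part already counted at stage s is at most 2^(2k) times the
  -- part in `alpha`, so subtracting it preserves the ratio.
  have hle : ∀ n, (1 / 2 : ℝ) ^ max (H n s) (G n s - 2 * k) ≤ (1 / 2) ^ G n s * 2 ^ (2 * k) := by
    intro n
    refine (half_pow_le (le_max_right _ _)).trans ?_
    have h1 : (1 / 2 : ℝ) ^ (G n s - 2 * k) =
        (1 / 2) ^ (G n s - 2 * k + 2 * k) * 2 ^ (2 * k) := by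
      rw [pow_add, mul_assoc, ← mul_pow]
      norm_num
    rw [h1]
    gcongr ?_ * _
    exact half_pow_le (by omega)
  have hterm : ∀ n, n < u → ((1 / 2 : ℝ) ^ G n u - (1 / 2) ^ G n s) * 2 ^ (2 * k) ≤
      (1 / 2) ^ max (H n v) (G n v - 2 * k) - (1 / 2) ^ max (H n s) (G n s - 2 * k) := by
    intro n hnu
    rcases lt_or_ge n N with hn | hn
    · rw [hGs n hn, sub_self, zero_mul]
      exact sub_nonneg.2 (half_pow_le (max_le_max (hH n (hu.trans huv))
        (Nat.sub_le_sub_right (hG n (hu.trans huv)) _)))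
    · have := hv n hn hnu
      have := hle n
      linarith
  have hα : alpha G u - alpha G s = ∑ n ∈ Finset.range s, ((1 / 2 : ℝ) ^ G n u - (1 / 2) ^ G n s) +
      ∑ n ∈ Finset.Ico s u, (1 / 2 : ℝ) ^ G n u := by
    unfold alpha
    rw [Finset.sum_sub_distrib, ← Finset.sum_range_add_sum_Ico _ hu]
    ring
  have hβ : ∑ n ∈ Finset.range s, ((1 / 2 : ℝ) ^ max (H n v) (G n v - 2 * k) -
      (1 / 2) ^ max (H n s) (G n s - 2 * k)) +
      ∑ n ∈ Finset.Ico s u, (1 / 2 : ℝ) ^ max (H n v) (G n v - 2 * k) ≤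
      beta G H k v - beta G H k s := by
    unfold beta
    have : ∑ n ∈ Finset.range u, (1 / 2 : ℝ) ^ max (H n v) (G n v - 2 * k) ≤
        ∑ n ∈ Finset.range v, (1 / 2 : ℝ) ^ max (H n v) (G n v - 2 * k) :=
      Finset.sum_le_sum_of_subset_of_nonneg (Finset.range_mono huv) fun _ _ _ => by positivity
    rw [← Finset.sum_range_add_sum_Ico _ hu] at this
    rw [Finset.sum_sub_distrib]
    linarith
  refine le_trans ?_ hβ
  rw [hα, add_mul, Finset.sum_mul, Finset.sum_mul]
  refine add_le_add (Finset.sum_le_sum fun n hn => hterm n ?_)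
    (Finset.sum_le_sum fun n hn => hv n ?_ ?_)
  · exact (Finset.mem_range.1 hn).trans_le hu
  · exact le_trans (by omega) (Finset.mem_Ico.1 hn).1
  · exact (Finset.mem_Ico.1 hn).2

/-- If `G n - H n` is eventually at least `2 * k` for almost all `n`, then the process restarts
only finitely often. -/
theorem exists_restarts_le (hG : ∀ n, Antitone (G n)) (hH : ∀ n, Antitone (H n))
    (hsum : ∀ s, ∑ n ∈ Finset.range s, (1 / 2 : ℝ) ^ H n s ≤ 1)
    (hGsum : ∀ s, alpha G s ≤ 1) {k N : ℕ} (hk : 0 < k)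
    (hN : ∀ n ≥ N, ∃ s, ∀ u ≥ s, H n u + 2 * k ≤ G n u) :
    ∃ t, ∀ s, (restarts G H k s).2 ≤ t := by
  by_contra! hunb
  have hbα : BddAbove (Set.range (alpha G)) := ⟨1, by rintro _ ⟨s, rfl⟩; exact hGsum s⟩
  have hbβ : BddAbove (Set.range (beta G H k)) :=
    ⟨1, by rintro _ ⟨s, rfl⟩; exact beta_le_one hsum k s⟩
  have hrestart : ∀ t, ∃ s ≥ t, exhausted G H k s (restarts G H k s) = true := by
    intro t
    by_contra! hno
    have hconst : ∀ s ≥ t, restarts G H k s = restarts G H k t := fun s hs => by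
      induction s, hs using Nat.le_induction with
      | base => rfl
      | succ s hs ih =>
        rw [restarts_succ, Bool.eq_false_iff.2 (hno s hs), cond_false, ih]
    obtain ⟨s, hs⟩ := hunb (restarts G H k t).2
    rcases le_total s t with h | h
    · exact absurd (restarts_snd_mono G H k h) (not_le.2 hs)
    · rw [hconst s h] at hs
      exact lt_irrefl _ hs
  have hfst : ∀ t, ∃ s ≥ t, t ≤ (restarts G H k s).1 := by
    intro t
    obtain ⟨r, hr⟩ := hunb t
    obtain ⟨s, hs, hex⟩ := hrestart (max r t)
    refine ⟨s + 1, by have := le_max_right r t; omega, ?_⟩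
    rw [restarts_succ, hex, cond_true]
    exact hr.le.trans (restarts_snd_mono G H k ((le_max_left r t).trans hs))
  -- The restart condition says precisely that this quantity does not decrease when the pair of
  -- restarts is updated.
  have hQ : Monotone fun s => alpha G (restarts G H k s).2 * 2 ^ k -
      beta G H k (restarts G H k s).1 := monotone_nat_of_le_succ fun s => by
    rw [restarts_succ]
    have hiff := exhausted_restarts_iff hG hH k s
    cases h : exhausted G H k s (restarts G H k s)
    · exact le_rfl
    · have := hiff.1 h
      simp only [cond_true]
      linarith
  -- Under infinitely many restarts both components of the pair are unbounded, so the monotone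
  -- quantity is bounded by its formal limit. This says that the tail of `beta` is at most 2^k times
  -- that of `alpha`.
  have hQle : ∀ s, alpha G (restarts G H k s).2 * 2 ^ k - beta G H k (restarts G H k s).1 ≤
      (⨆ s, alpha G s) * 2 ^ k - ⨆ s, beta G H k s := by
    intro s
    have : (⨆ s, beta G H k s) ≤ (⨆ s, alpha G s) * 2 ^ k -
        (alpha G (restarts G H k s).2 * 2 ^ k - beta G H k (restarts G H k s).1) := by
      refine ciSup_le fun u => ?_
      obtain ⟨s', hs', hu⟩ := hfst (max u s)
      have h1 := hQ ((le_max_right u s).trans hs')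
      have h2 := beta_mono hG hH k ((le_max_left u s).trans hu)
      have h3 : alpha G (restarts G H k s').2 * 2 ^ k ≤ (⨆ s, alpha G s) * 2 ^ k :=
        mul_le_mul_of_nonneg_right (le_ciSup hbα _) (by positivity)
      simp only at h1
      linarith
    linarith
  obtain ⟨s₀, hs₀⟩ := growth_le_beta_growth hG hH hN
  obtain ⟨s, -, hs⟩ := hfst s₀
  have hgap : ((⨆ s, alpha G s) - alpha G (restarts G H k s).1) * 2 ^ (2 * k) ≤
      (⨆ s, beta G H k s) - beta G H k (restarts G H k s).1 := by
    have : (⨆ s, alpha G s) ≤ ((⨆ s, beta G H k s) - beta G H k (restarts G H k s).1) /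
        2 ^ (2 * k) + alpha G (restarts G H k s).1 := by
      refine ciSup_le fun u => ?_
      refine (alpha_mono hG (le_max_left u (restarts G H k s).1)).trans ?_
      obtain ⟨v, hv⟩ := hs₀ _ hs _ (le_max_right u (restarts G H k s).1)
      rw [← sub_le_iff_le_add, le_div_iff₀ (by positivity)]
      exact hv.trans (sub_le_sub_right (le_ciSup hbβ v) _)
    rwa [← sub_le_iff_le_add, le_div_iff₀ (by positivity)] at this
  have h1 := hQle s
  have h2 := alpha_mono hG (restarts_le G H k s).1
  -- The tail of `alpha` is nonzero because each stage adds a new positive term. It can be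
  -- cancelled, leaving 2^(2k) ≤ 2^k, which is absurd for k > 0.
  have h3 : 0 < (⨆ s, alpha G s) - alpha G (restarts G H k s).2 :=
    sub_pos.2 ((alpha_lt_succ hG _).trans_le (le_ciSup hbα _))
  have h4 : ((⨆ s, alpha G s) - alpha G (restarts G H k s).2) * 2 ^ (2 * k) ≤
      ((⨆ s, alpha G s) - alpha G (restarts G H k s).1) * 2 ^ (2 * k) :=
    mul_le_mul_of_nonneg_right (by linarith) (by positivity)
  have h5 : ((⨆ s, alpha G s) - alpha G (restarts G H k s).2) * 2 ^ (2 * k) ≤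
      ((⨆ s, alpha G s) - alpha G (restarts G H k s).2) * 2 ^ k := by linarith
  have h6 : (2 : ℝ) ^ k < 2 ^ (2 * k) := pow_lt_pow_right₀ (by norm_num) (by omega)
  exact absurd (le_of_mul_le_mul_left h5 h3) (not_le.2 h6)

end Markers

/-! ### Descriptions requested for sets of markers -/

section Requests

variable (G H : ℕ → ℕ → ℕ)

/-- The `k`-th marker at stage `s`. -/
def marker (k s : ℕ) : ℕ := ∑ j ∈ Finset.range (k + 1), ((restarts G H (2 * j + 1) s).2 + 1)

/-- The characteristic string of length `n` of those of the markers `p 0, ..., p m` whose index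
belongs to the set of binary digits of `F`. -/
def markerString (p : ℕ → ℕ) (m F n : ℕ) : List Bool :=
  (List.range n).map fun i => (List.range (m + 1)).any fun k => F.testBit k && decide (p k = i)

/-- Whether the weight of `n` grows at stage `s + 1`, while the process of level `m` does not
restart. -/
def grows (a : ℕ × ℕ × ℕ × ℕ) : Bool :=
  decide (a.2.1 < 2 ^ (a.1 + 1)) && (!exhausted G H (2 * a.1 + 1) a.2.2.1
    (restarts G H (2 * a.1 + 1) a.2.2.1) && (decide (a.2.2.2 ≤ a.2.2.1) &&
      (decide (a.2.2.2 = a.2.2.1) || decide (G a.2.2.2 (a.2.2.1 + 1) < G a.2.2.2 a.2.2.1))))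

/-- The request at `(m, F, s, n)`. -/
def markerRequest (a : ℕ × ℕ × ℕ × ℕ) : Option (ℕ × List Bool) :=
  bif grows G H a then some (G a.2.2.2 (a.2.2.1 + 1),
    markerString (fun k => marker G H k (a.2.2.1 + 1)) a.1 a.2.1 a.2.2.2) else none

variable {G H}

theorem computable_restarts (hGc : Computable₂ G) (hHc : Computable₂ H) :
    Computable (fun a : ℕ × ℕ => restarts G H a.1 a.2) ∧
    Computable (fun a : ℕ × ℕ × (ℕ × ℕ) => exhausted G H a.1 a.2.1 a.2.2) := by
  have hG' : Computable fun a : ℕ × ℕ => G a.1 a.2 := hGc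
  have hH' : Computable fun a : ℕ × ℕ => H a.1 a.2 := hHc
  have hbound : Computable (expBound G H) := by
    refine Computable.sum_range (f := fun _ n => G n 0 + H n 0) (h := fun s => s) ?_ Computable.id
    exact (by fun_prop : Computable fun a : ℕ × ℕ => G a.2 0 + H a.2 0)
  have hα : Computable fun a : ℕ × ℕ => alphaNum G a.1 a.2 := by
    refine Computable.sum_range (f := fun (a : ℕ × ℕ) n => 2 ^ (a.2 - G n a.1))
      (h := fun a => a.1) ?_ (by fun_prop)
    exact (by fun_prop : Computable fun q : (ℕ × ℕ) × ℕ => 2 ^ (q.1.2 - G q.2 q.1.1))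
  have hβ : Computable fun a : ℕ × ℕ × ℕ => betaNum G H a.1 a.2.1 a.2.2 := by
    refine Computable.sum_range (f := fun (a : ℕ × ℕ × ℕ) n =>
      2 ^ (a.2.2 - max (H n a.2.1) (G n a.2.1 - 2 * a.1))) (h := fun a => a.2.1) ?_ (by fun_prop)
    exact (by fun_prop : Computable fun q : (ℕ × ℕ × ℕ) × ℕ =>
      2 ^ (q.1.2.2 - max (H q.2 q.1.2.1) (G q.2 q.1.2.1 - 2 * q.1.1)))
  have hex : Computable fun a : ℕ × ℕ × (ℕ × ℕ) => exhausted G H a.1 a.2.1 a.2.2 := by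
    unfold exhausted
    have hα1 : Computable fun a : ℕ × ℕ × (ℕ × ℕ) => alphaNum G a.2.2.2 (expBound G H (a.2.1 + 1)) :=
      hα.comp (f := fun a : ℕ × ℕ => alphaNum G a.1 a.2)
        (g := fun a : ℕ × ℕ × (ℕ × ℕ) => (a.2.2.2, expBound G H (a.2.1 + 1))) (by fun_prop)
    have hα2 : Computable fun a : ℕ × ℕ × (ℕ × ℕ) =>
        alphaNum G (a.2.1 + 1) (expBound G H (a.2.1 + 1)) :=
      hα.comp (f := fun a : ℕ × ℕ => alphaNum G a.1 a.2)
        (g := fun a : ℕ × ℕ × (ℕ × ℕ) => (a.2.1 + 1, expBound G H (a.2.1 + 1))) (by fun_prop)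
    have hβ1 : Computable fun a : ℕ × ℕ × (ℕ × ℕ) =>
        betaNum G H a.1 a.2.2.2 (expBound G H (a.2.1 + 1)) :=
      hβ.comp (f := fun a : ℕ × ℕ × ℕ => betaNum G H a.1 a.2.1 a.2.2)
        (g := fun a : ℕ × ℕ × (ℕ × ℕ) => (a.1, a.2.2.2, expBound G H (a.2.1 + 1))) (by fun_prop)
    have hβ2 : Computable fun a : ℕ × ℕ × (ℕ × ℕ) =>
        betaNum G H a.1 a.2.2.1 (expBound G H (a.2.1 + 1)) :=
      hβ.comp (f := fun a : ℕ × ℕ × ℕ => betaNum G H a.1 a.2.1 a.2.2)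
        (g := fun a : ℕ × ℕ × (ℕ × ℕ) => (a.1, a.2.2.1, expBound G H (a.2.1 + 1))) (by fun_prop)
    have hpow : Computable fun a : ℕ × ℕ × (ℕ × ℕ) => 2 ^ a.1 := by fun_prop
    exact Computable.decide_le (Computable.add_apply (Computable.mul_apply hα1 hpow) hβ1)
      (Computable.add_apply (Computable.mul_apply hα2 hpow) hβ2)
  refine ⟨?_, hex⟩
  refine Computable.nat_rec (f := fun a : ℕ × ℕ => a.2) (g := fun _ => ((0, 0) : ℕ × ℕ))
    (h := fun a q => bif exhausted G H a.1 q.1 q.2 then (q.2.2, q.1 + 1) else q.2)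
    (by fun_prop) (by fun_prop) ?_
  have hex' : Computable fun a : (ℕ × ℕ) × (ℕ × (ℕ × ℕ)) => exhausted G H a.1.1 a.2.1 a.2.2 :=
    hex.comp (f := fun a : ℕ × ℕ × (ℕ × ℕ) => exhausted G H a.1 a.2.1 a.2.2)
      (g := fun a : (ℕ × ℕ) × (ℕ × (ℕ × ℕ)) => (a.1.1, a.2.1, a.2.2)) (by fun_prop)
  exact Computable.cond hex' (by fun_prop) (by fun_prop)

theorem computable_markerRequest (hGc : Computable₂ G) (hHc : Computable₂ H) :
    Computable (markerRequest G H) := by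
  have hG' : Computable fun a : ℕ × ℕ => G a.1 a.2 := hGc
  obtain ⟨hr, hex⟩ := computable_restarts hGc hHc
  have hmk : Computable fun a : ℕ × ℕ => marker G H a.1 a.2 := by
    refine Computable.sum_range (f := fun (a : ℕ × ℕ) j => (restarts G H (2 * j + 1) a.2).2 + 1)
      (h := fun a => a.1 + 1) ?_ (by fun_prop)
    have : Computable fun q : (ℕ × ℕ) × ℕ => restarts G H (2 * q.2 + 1) q.1.2 :=
      hr.comp (f := fun a : ℕ × ℕ => restarts G H a.1 a.2)
        (g := fun q : (ℕ × ℕ) × ℕ => (2 * q.2 + 1, q.1.2)) (by fun_prop)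
    exact Computable.add_apply (Computable.snd_apply this) (Computable.const 1)
  have hstr : Computable fun a : ℕ × ℕ × ℕ × ℕ =>
      markerString (fun k => marker G H k (a.2.2.1 + 1)) a.1 a.2.1 a.2.2.2 := by
    refine Computable.map_range (f := fun (a : ℕ × ℕ × ℕ × ℕ) i => (List.range (a.1 + 1)).any
      fun k => a.2.1.testBit k && decide (marker G H k (a.2.2.1 + 1) = i))
      (h := fun a => a.2.2.2) ?_ (by fun_prop)
    refine Computable.any_range (f := fun (q : (ℕ × ℕ × ℕ × ℕ) × ℕ) k =>
      q.1.2.1.testBit k && decide (marker G H k (q.1.2.2.1 + 1) = q.2))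
      (h := fun q => q.1.1 + 1) ?_ (by fun_prop)
    have : Computable fun w : ((ℕ × ℕ × ℕ × ℕ) × ℕ) × ℕ => marker G H w.2 (w.1.1.2.2.1 + 1) :=
      hmk.comp (f := fun a : ℕ × ℕ => marker G H a.1 a.2)
        (g := fun w : ((ℕ × ℕ × ℕ × ℕ) × ℕ) × ℕ => (w.2, w.1.1.2.2.1 + 1)) (by fun_prop)
    exact Computable.and_apply (by fun_prop) (Computable.decide_eq this (by fun_prop))
  have hg : Computable (grows G H) := by
    have hr' : Computable fun a : ℕ × ℕ × ℕ × ℕ => restarts G H (2 * a.1 + 1) a.2.2.1 :=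
      hr.comp (f := fun a : ℕ × ℕ => restarts G H a.1 a.2)
        (g := fun a : ℕ × ℕ × ℕ × ℕ => (2 * a.1 + 1, a.2.2.1)) (by fun_prop)
    have hex' : Computable fun a : ℕ × ℕ × ℕ × ℕ => exhausted G H (2 * a.1 + 1) a.2.2.1
        (restarts G H (2 * a.1 + 1) a.2.2.1) :=
      hex.comp (f := fun a : ℕ × ℕ × (ℕ × ℕ) => exhausted G H a.1 a.2.1 a.2.2)
        (g := fun a : ℕ × ℕ × ℕ × ℕ => (2 * a.1 + 1, a.2.2.1, restarts G H (2 * a.1 + 1) a.2.2.1))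
        (Computable.pair (by fun_prop) (Computable.pair (by fun_prop) hr'))
    have hG0 : Computable fun a : ℕ × ℕ × ℕ × ℕ => G a.2.2.2 a.2.2.1 := by fun_prop
    have hG1 : Computable fun a : ℕ × ℕ × ℕ × ℕ => G a.2.2.2 (a.2.2.1 + 1) := by fun_prop
    have hpow : Computable fun a : ℕ × ℕ × ℕ × ℕ => 2 ^ (a.1 + 1) := by fun_prop
    exact Computable.and_apply (Computable.decide_lt (by fun_prop) hpow)
      (Computable.and_apply (Computable.not_apply hex')
        (Computable.and_apply (Computable.decide_le (by fun_prop) (by fun_prop))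
          (Computable.or_apply (Computable.decide_eq (by fun_prop) (by fun_prop))
            (Computable.decide_lt hG1 hG0))))
  exact Computable.cond hg (Computable.some_apply (Computable.pair (by fun_prop) hstr))
    (Computable.const none)

theorem ENNReal.ofReal_half_pow (n : ℕ) : ENNReal.ofReal ((1 / 2) ^ n) = 2⁻¹ ^ n := by
  rw [ENNReal.ofReal_pow (by norm_num), one_div, ENNReal.ofReal_inv_of_pos (by norm_num)]
  simp

theorem tsum_ofReal_le {f : ℕ → ℝ} {c : ℝ} (h0 : ∀ n, 0 ≤ f n)
    (h : ∀ n, ∑ i ∈ Finset.range n, f i ≤ c) : ∑' i, ENNReal.ofReal (f i) ≤ ENNReal.ofReal c := by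
  rw [ENNReal.tsum_eq_iSup_nat]
  refine iSup_le fun n => ?_
  rw [← ENNReal.ofReal_sum_of_nonneg fun i _ => h0 i]
  exact ENNReal.ofReal_le_ofReal (h n)

/-- When an exponent drops by at least one, the new weight is at most twice the increase of the
weight. The newly considered n = s contributes its whole weight to the increase. -/
theorem tsum_stage_le (hG : ∀ n, Antitone (G n)) (m F s : ℕ) :
    ∑' n, (markerRequest G H (m, F, s, n)).elim 0 (fun q => (2⁻¹ : ℝ≥0∞) ^ q.1) ≤
      ENNReal.ofReal (2 * if exhausted G H (2 * m + 1) s (restarts G H (2 * m + 1) s) then 0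
        else alpha G (s + 1) - alpha G s) := by
  by_cases hex : exhausted G H (2 * m + 1) s (restarts G H (2 * m + 1) s) = true
  · simp [markerRequest, grows, hex]
  rw [if_neg hex]
  rw [tsum_eq_sum (s := Finset.range (s + 1)) fun n hn => by
    have : ¬ n ≤ s := by simpa using hn
    simp [markerRequest, grows, this]]
  have hle : ∀ n, (markerRequest G H (m, F, s, n)).elim 0 (fun q => (2⁻¹ : ℝ≥0∞) ^ q.1) ≤
      if n = s ∨ G n (s + 1) < G n s then ENNReal.ofReal ((1 / 2) ^ G n (s + 1)) else 0 := by
    intro n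
    cases hg : grows G H (m, F, s, n)
    · simp [markerRequest, hg]
    · have h1 : n = s ∨ G n (s + 1) < G n s := by
        simp only [grows, Bool.and_eq_true, Bool.or_eq_true, decide_eq_true_eq] at hg
        exact hg.2.2.2
      rw [if_pos h1, ENNReal.ofReal_half_pow]
      simp [markerRequest, hg]
  refine (Finset.sum_le_sum fun n _ => hle n).trans ?_
  have hα : 2 * (alpha G (s + 1) - alpha G s) = ∑ n ∈ Finset.range s,
      2 * ((1 / 2 : ℝ) ^ G n (s + 1) - (1 / 2) ^ G n s) + 2 * (1 / 2) ^ G s (s + 1) := by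
    unfold alpha
    rw [Finset.sum_range_succ, ← Finset.mul_sum, Finset.sum_sub_distrib]
    ring
  have hnn : ∀ n, 0 ≤ 2 * ((1 / 2 : ℝ) ^ G n (s + 1) - (1 / 2) ^ G n s) := fun n => by
    have := half_pow_le (hG n s.le_succ)
    linarith
  rw [hα, ENNReal.ofReal_add (Finset.sum_nonneg fun n _ => hnn n) (by positivity),
    ENNReal.ofReal_sum_of_nonneg fun n _ => hnn n, Finset.sum_range_succ]
  refine add_le_add (Finset.sum_le_sum fun n hn => ?_) ?_
  · split_ifs with h
    · refine ENNReal.ofReal_le_ofReal ?_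
      have hlt : G n (s + 1) + 1 ≤ G n s := by
        rcases h with h | h
        · exact absurd h (Finset.mem_range.1 hn).ne
        · exact h
      have h1 := half_pow_le hlt
      rw [pow_succ] at h1
      linarith
    · exact zero_le
  · rw [if_pos (Or.inl rfl)]
    refine ENNReal.ofReal_le_ofReal ?_
    have : (0 : ℝ) < (1 / 2) ^ G s (s + 1) := by positivity
    linarith

/-- At level m there are 2^(m+1) sets of markers, each costing at most 2 · 2^(-(2m+1)). This is 2 ·
2^(-m) per level, which is summable and explains the parameter 2m + 1. -/
theorem tsum_markerRequest_ne_top (hG : ∀ n, Antitone (G n)) (hH : ∀ n, Antitone (H n))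
    (hsum : ∀ s, ∑ n ∈ Finset.range s, (1 / 2 : ℝ) ^ H n s ≤ 1) :
    ∑' a, (markerRequest G H a).elim 0 (fun q => (2⁻¹ : ℝ≥0∞) ^ q.1) ≠ ∞ := by
  have h1 : ∀ m F, ∑' b : ℕ × ℕ, (markerRequest G H (m, F, b)).elim 0
      (fun q => (2⁻¹ : ℝ≥0∞) ^ q.1) ≤ if F < 2 ^ (m + 1) then 2⁻¹ ^ (2 * m) else 0 := by
    intro m F
    split_ifs with hF
    · rw [ENNReal.tsum_prod']
      refine (ENNReal.tsum_le_tsum fun s => tsum_stage_le hG m F s).trans ?_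
      rw [← ENNReal.ofReal_half_pow]
      refine tsum_ofReal_le (fun s => ?_) fun S => ?_
      · split_ifs
        · simp
        · have := alpha_mono hG s.le_succ
          linarith
      · rw [← Finset.mul_sum]
        have := sum_growth_le hG hH hsum (2 * m + 1) S
        rw [pow_succ] at this
        linarith
    · simp [markerRequest, grows, hF]
  have h2 : ∀ m, ∑' b : ℕ × ℕ × ℕ, (markerRequest G H (m, b)).elim 0
      (fun q => (2⁻¹ : ℝ≥0∞) ^ q.1) ≤ 2 * 2⁻¹ ^ m := by
    intro m
    rw [ENNReal.tsum_prod']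
    refine (ENNReal.tsum_le_tsum fun F => h1 m F).trans ?_
    rw [tsum_eq_sum (s := Finset.range (2 ^ (m + 1))) fun F hF => if_neg (by simpa using hF)]
    rw [Finset.sum_congr rfl fun F hF => if_pos (Finset.mem_range.1 hF), Finset.sum_const,
      Finset.card_range, nsmul_eq_mul]
    push_cast
    rw [pow_succ', two_mul m, pow_add, mul_assoc, ← mul_assoc (2 ^ m), mul_comm (2 ^ m),
      ENNReal.inv_two_pow_mul_two_pow, one_mul]
  rw [ENNReal.tsum_prod']
  have h3 := ENNReal.tsum_le_tsum h2
  rw [ENNReal.tsum_mul_left, ENNReal.tsum_geometric, ENNReal.one_sub_inv_two, inv_inv] at h3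
  exact ne_top_of_le_ne_top (by finiteness) h3

end Requests

/-! ### An uncountable family of sequences -/

section Perfect

variable {G H : ℕ → ℕ → ℕ} {U : List Bool →. List Bool}

theorem markerString_congr {p q : ℕ → ℕ} {m F n : ℕ} (h : ∀ k ≤ m, p k = q k) :
    markerString p m F n = markerString q m F n := by
  unfold markerString
  refine List.map_congr_left fun i _ => ?_
  rw [Bool.eq_iff_iff, List.any_eq_true, List.any_eq_true]
  refine exists_congr fun k => and_congr_right fun hk => ?_
  rw [h k (Nat.lt_succ_iff.1 (List.mem_range.1 hk))]

/-- There are uncountably many sequences whose initial segments have complexity at most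
`lim G n + O(1)`, provided that `G n` exceeds the complexity of `n` by more and more. -/
theorem IsUniversalPrefixFreeMachine.exists_injective_le (hU : IsUniversalPrefixFreeMachine U)
    (hGc : Computable₂ G) (hHc : Computable₂ H) (hG : ∀ n, Antitone (G n))
    (hH : ∀ n, Antitone (H n)) (hsum : ∀ s, ∑ n ∈ Finset.range s, (1 / 2 : ℝ) ^ H n s ≤ 1)
    (hGsum : ∀ s, alpha G s ≤ 1)
    (hgap : ∀ k, ∃ N, ∀ n ≥ N, ∃ s, ∀ u ≥ s, H n u + 2 * k ≤ G n u) :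
    ∃ Φ : (ℕ → Bool) → ℕ → Bool, Function.Injective Φ ∧ ∀ X, ∃ c, ∀ n u,
      prefixComplexity U (initialSegment (Φ X) n) ≤ G n u + c := by
  obtain ⟨c, hc⟩ := hU.exists_le_of_requests (computable_markerRequest hGc hHc)
    (tsum_markerRequest_ne_top hG hH hsum)
  have hlim : ∀ j, ∃ t, ∀ s ≥ t, (restarts G H (2 * j + 1) s).2 = t := by
    intro j
    obtain ⟨N, hN⟩ := hgap (2 * j + 1)
    obtain ⟨b, hb⟩ := exists_restarts_le hG hH hsum hGsum (Nat.succ_pos _) hN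
    obtain ⟨s₀, hs₀⟩ : ∃ s₀, ∀ s, (restarts G H (2 * j + 1) s).2 ≤
        (restarts G H (2 * j + 1) s₀).2 := by
      have hfin : (Set.range fun s => (restarts G H (2 * j + 1) s).2).Finite :=
        (Set.finite_Iic b).subset (by rintro _ ⟨s, rfl⟩; exact hb s)
      obtain ⟨_, ⟨s₀, rfl⟩, h⟩ := Set.exists_max_image _ id hfin (Set.range_nonempty _)
      exact ⟨s₀, fun s => h _ ⟨s, rfl⟩⟩
    refine ⟨_, fun s hs => le_antisymm (hs₀ s) ?_⟩
    rw [← restarts_snd_restarts_snd G H _ s₀]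
    exact restarts_snd_mono G H _ hs
  choose t ht using hlim
  let p : ℕ → ℕ := fun k => ∑ j ∈ Finset.range (k + 1), (t j + 1)
  have hp : StrictMono p := strictMono_nat_of_lt_succ fun k => by
    simp only [p, Finset.sum_range_succ _ (k + 1)]
    omega
  -- Every length n ≥ p m exceeds or equals the settling times of levels 0, ..., m. Thus at stages s
  -- ≥ n the markers p 0, ..., p m are final and level m never restarts.
  have htp : ∀ j k, j ≤ k → t j ≤ p k := fun j k hjk => by
    have := Finset.single_le_sum (f := fun j => t j + 1) (fun _ _ => Nat.zero_le _)
      (Finset.mem_range.2 (Nat.lt_succ_of_le hjk))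
    exact (Nat.le_succ _).trans this
  have hmarker : ∀ m n, p m ≤ n → ∀ s ≥ n, ∀ k ≤ m, marker G H k (s + 1) = p k := by
    intro m n hmn s hs k hk
    refine Finset.sum_congr rfl fun j hj => ?_
    rw [ht j (s + 1) ?_]
    exact (htp j m ((Nat.lt_succ_iff.1 (Finset.mem_range.1 hj)).trans hk)).trans (by omega)
  have hstring : ∀ m F n u, F < 2 ^ (m + 1) → p m ≤ n →
      prefixComplexity U (markerString p m F n) ≤ G n u + c := by
    intro m F n u hF hmn
    have hne : ∀ s ≥ n, exhausted G H (2 * m + 1) s (restarts G H (2 * m + 1) s) = false := by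
      intro s hs
      by_contra h
      rw [Bool.not_eq_false] at h
      have hts : t m ≤ s := (htp m m le_rfl).trans (hmn.trans hs)
      have h1 := ht m (s + 1) (hts.trans s.le_succ)
      rw [restarts_succ, h, cond_true] at h1
      simp only at h1
      omega
    have hreq : ∀ s ≥ n, (n = s ∨ G n (s + 1) < G n s) →
        prefixComplexity U (markerString p m F n) ≤ G n (s + 1) + c := by
      intro s hs h
      refine hc (m, F, s, n) _ _ ?_
      have hg : grows G H (m, F, s, n) = true := by
        simp only [grows, Bool.and_eq_true, Bool.or_eq_true, decide_eq_true_eq, Bool.not_eq_true']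
        exact ⟨hF, hne s hs, hs, h⟩
      simp only [markerRequest, hg, cond_true]
      rw [markerString_congr (hmarker m n hmn s hs)]
    -- A first request is made when n enters at stage n, and another at every later drop of `G n`.
    -- Between drops the previous bound persists.
    have hall : ∀ s ≥ n, prefixComplexity U (markerString p m F n) ≤ G n (s + 1) + c := by
      intro s hs
      induction s, hs using Nat.le_induction with
      | base => exact hreq n le_rfl (Or.inl rfl)
      | succ s hs ih =>
        rcases (hG n (s + 1).le_succ).lt_or_eq with h | h
        · exact hreq (s + 1) (hs.trans s.le_succ) (Or.inr h)
        · exact ih.trans (Nat.add_le_add_right h.ge c)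
    exact (hall (max n u) (le_max_left _ _)).trans (Nat.add_le_add_right
      (hG n ((le_max_right n u).trans (Nat.le_succ _))) c)
  classical
  refine ⟨fun X i => decide (∃ k, X k = true ∧ p k = i), fun X Y hXY => ?_, fun X => ?_⟩
  · funext k
    have hdec : ∀ Z : ℕ → Bool, decide (∃ j, Z j = true ∧ p j = p k) = Z k := by
      intro Z
      rw [Bool.eq_iff_iff, decide_eq_true_iff]
      exact ⟨fun ⟨j, hj, hjk⟩ => hp.injective hjk ▸ hj, fun h => ⟨k, h, rfl⟩⟩
    have := congrFun hXY (p k)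
    simp only [hdec] at this
    exact this
  · set A : ℕ → Bool := fun i => decide (∃ k, X k = true ∧ p k = i)
    -- The sum absorbs the finitely many lengths below the first marker.
    refine ⟨c + ∑ n ∈ Finset.range (p 0), prefixComplexity U (initialSegment A n), fun n u => ?_⟩
    change prefixComplexity U (initialSegment A n) ≤ _
    rcases lt_or_ge n (p 0) with hn | hn
    · have := Finset.single_le_sum (f := fun n => prefixComplexity U (initialSegment A n))
        (fun _ _ => Nat.zero_le _) (Finset.mem_range.2 hn)
      omega
    · obtain ⟨m, hm1, hm2⟩ : ∃ m, p m ≤ n ∧ n < p (m + 1) := by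
        have hex : ∃ m, n < p m := ⟨n + 1, (Nat.lt_succ_self n).trans_le (hp.id_le _)⟩
        obtain ⟨m, hm⟩ := Nat.exists_eq_succ_of_ne_zero (n := Nat.find hex) fun h0 => by
          have := Nat.find_spec hex
          rw [h0] at this
          omega
        exact ⟨m, not_lt.1 (Nat.find_min hex (by omega)), by
          rw [← Nat.succ_eq_add_one, ← hm]; exact Nat.find_spec hex⟩
      -- As n < p (m + 1), only the first m + 1 bits of `X` are visible, and they are packed into
      -- one number below 2^(m+1).
      have hseg : initialSegment A n =
          markerString p m (Nat.ofBits fun k : Fin (m + 1) => X k) n := by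
        unfold initialSegment markerString
        refine List.map_congr_left fun i hi => ?_
        rw [Bool.eq_iff_iff, decide_eq_true_iff, List.any_eq_true]
        constructor
        · rintro ⟨k, hk, hki⟩
          have hkm : k < m + 1 := hp.lt_iff_lt.1 ((hki ▸ List.mem_range.1 hi).trans hm2)
          refine ⟨k, List.mem_range.2 hkm, ?_⟩
          rw [Nat.testBit_ofBits_lt _ _ hkm]
          simp [hk, hki]
        · rintro ⟨k, hkm, hk⟩
          have hkm' := List.mem_range.1 hkm
          rw [Nat.testBit_ofBits_lt _ _ hkm'] at hk
          simp only [Bool.and_eq_true, decide_eq_true_eq] at hk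
          exact ⟨k, hk⟩
      rw [hseg]
      exact (hstring m _ n u (Nat.ofBits_lt_two_pow _) hm1).trans (by omega)

end Perfect

/-! ### Integer approximations and the uncountability statement -/

section Approximation

variable {U : List Bool →. List Bool}

/-- A right-c.e. upper bound for the complexity is, up to a constant, the limit of a computable
nonincreasing approximation by natural numbers that are upper bounds for the complexity. -/
theorem IsRightCE.exists_nat_approximation {g : ℕ → ℝ} (hg : IsRightCE g)
    (hb : IsComplexityUpperBound U g) :
    ∃ (G : ℕ → ℕ → ℕ) (C : ℕ), Computable₂ G ∧ (∀ n, Antitone (G n)) ∧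
      (∀ n t, natPrefixComplexity U n ≤ G n t) ∧ (∀ n t, g n ≤ G n t) ∧
      ∀ n, ∃ t, (G n t : ℝ) ≤ g n + C := by
  obtain ⟨a, b, q, ha, hb', hq, hlim⟩ := hg
  obtain ⟨C, hC⟩ := hb
  let v : ℕ → ℕ → ℝ := fun n t => ((a n t : ℝ) - b n t) / 2 ^ q n t
  have hgv : ∀ n t, g n ≤ v n t := fun n t => (hlim n).1.le_of_tendsto (hlim n).2 t
  -- This is the floor of `v n t + C`. Truncated subtraction is exact because that number is bounded
  -- below by K(n) ≥ 0.
  let f : ℕ → ℕ → ℕ := fun n t => (a n t + C * 2 ^ q n t - b n t) / 2 ^ q n t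
  have hpos : ∀ n t, (0 : ℝ) < 2 ^ q n t := fun n t => by positivity
  have hnn : ∀ n t, 0 ≤ v n t + C := fun n t => by
    have h1 := hC n
    have h2 := hgv n t
    have h3 : (0 : ℝ) ≤ natPrefixComplexity U n := Nat.cast_nonneg _
    linarith
  have hval : ∀ n t, ((a n t + C * 2 ^ q n t - b n t : ℕ) : ℝ) = (v n t + C) * 2 ^ q n t := by
    intro n t
    have h1 : (v n t + C) * 2 ^ q n t = a n t + C * 2 ^ q n t - b n t := by
      simp only [v, add_mul, div_mul_cancel₀ _ (hpos n t).ne']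
      ring
    have h2 : b n t ≤ a n t + C * 2 ^ q n t := by
      have := mul_nonneg (hnn n t) (hpos n t).le
      rw [h1, sub_nonneg] at this
      exact_mod_cast this
    rw [h1, Nat.cast_sub h2]
    push_cast
    ring
  have hf : ∀ n t, f n t = ⌊v n t + C⌋₊ := by
    intro n t
    have h1 : v n t + C = ((a n t + C * 2 ^ q n t - b n t : ℕ) : ℝ) / ((2 ^ q n t : ℕ) : ℝ) := by
      rw [hval]
      push_cast
      rw [mul_div_cancel_right₀ _ (hpos n t).ne']
    rw [h1, Nat.floor_div_eq_div]
  have hfc : Computable₂ f := by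
    have ha' : Computable fun p : ℕ × ℕ => a p.1 p.2 := ha
    have hb'' : Computable fun p : ℕ × ℕ => b p.1 p.2 := hb'
    have hq' : Computable fun p : ℕ × ℕ => q p.1 p.2 := hq
    have hpw : Computable fun p : ℕ × ℕ => 2 ^ q p.1 p.2 :=
      Computable.pow_apply (Computable.const 2) hq'
    exact Computable.div_apply (Computable.sub_apply (Computable.add_apply ha'
      (Computable.mul_apply (Computable.const C) hpw)) hb'') hpw
  have hlt : ∀ n t, v n t + C < f n t + 1 := fun n t => by rw [hf]; exact Nat.lt_floor_add_one _
  -- Adding 1 to the floor keeps it above K(n). The constant C + 2 allows for this 1 and for a stage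
  -- at which the approximation is within 1 of g(n).
  refine ⟨fun n t => f n t + 1, C + 2, ?_, ?_, ?_, ?_, ?_⟩
  · exact Computable.add_apply (show Computable fun p : ℕ × ℕ => f p.1 p.2 from hfc)
      (Computable.const 1)
  · intro n s t hst
    have h1 : v n t ≤ v n s := (hlim n).1 hst
    simp only [hf]
    gcongr
  · intro n t
    have h1 := hlt n t
    have h2 := hgv n t
    have h3 := hC n
    have : (natPrefixComplexity U n : ℝ) ≤ ((f n t + 1 : ℕ) : ℝ) := by push_cast; linarith
    exact_mod_cast this
  · intro n t
    have h1 := hlt n t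
    have h2 := hgv n t
    have h3 : (0 : ℝ) ≤ C := Nat.cast_nonneg _
    push_cast
    linarith
  · intro n
    obtain ⟨t, ht⟩ := ((hlim n).2.eventually_lt_const (lt_add_one (g n))).exists
    refine ⟨t, ?_⟩
    have h1 : (f n t : ℝ) ≤ v n t + C := by rw [hf]; exact Nat.floor_le (hnn n t)
    have h2 : v n t < g n + 1 := ht
    push_cast
    linarith

/-- The complexity of a natural number, approximated from above by an enumeration of the
machine, starting from the bound `G n 0`. -/
def complexityApprox (G : ℕ → ℕ → ℕ) (E : ℕ → Option (List Bool × List Bool)) (n s : ℕ) : ℕ :=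
  Nat.rec (G n 0) (fun i k => (E i).elim k fun q =>
    bif decide (q.2 = n.bits) then min k q.1.length else k) s

theorem complexityApprox_succ (G : ℕ → ℕ → ℕ) (E : ℕ → Option (List Bool × List Bool)) (n s : ℕ) :
    complexityApprox G E n (s + 1) = (E s).elim (complexityApprox G E n s) fun q =>
      bif decide (q.2 = n.bits) then min (complexityApprox G E n s) q.1.length
      else complexityApprox G E n s := rfl

theorem computable_complexityApprox {G : ℕ → ℕ → ℕ} {E : ℕ → Option (List Bool × List Bool)}
    (hG : Computable₂ G) (hE : Computable E) : Computable₂ (complexityApprox G E) := by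
  have hG' : Computable fun p : ℕ × ℕ => G p.1 p.2 := hG
  have hG0 : Computable fun p : ℕ × ℕ => G p.1 0 := by fun_prop
  refine Computable.nat_rec (f := fun p : ℕ × ℕ => p.2) (g := fun p => G p.1 0)
    (h := fun p w => (E w.1).elim w.2 fun q =>
      bif decide (q.2 = p.1.bits) then min w.2 q.1.length else w.2) (by fun_prop) hG0 ?_
  exact Computable.option_elim_apply (f := fun z : (ℕ × ℕ) × (ℕ × ℕ) => E z.2.1)
    (c := fun z => z.2.2) (g := fun z q => bif decide (q.2 = z.1.1.bits)
      then min z.2.2 q.1.length else z.2.2) (by fun_prop) (by fun_prop) (by fun_prop)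

theorem complexityApprox_antitone (G : ℕ → ℕ → ℕ) (E : ℕ → Option (List Bool × List Bool))
    (n : ℕ) : Antitone (complexityApprox G E n) := antitone_nat_of_succ_le fun s => by
  rw [complexityApprox_succ]
  cases E s with
  | none => exact le_rfl
  | some q =>
    simp only [Option.elim_some, Bool.cond_eq_ite]
    split_ifs
    · exact min_le_left _ _
    · exact le_rfl

theorem le_complexityApprox {G : ℕ → ℕ → ℕ} {E : ℕ → Option (List Bool × List Bool)}
    (hmem : ∀ i p x, E i = some (p, x) → x ∈ U p) (hG : ∀ n t, natPrefixComplexity U n ≤ G n t)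
    (n s : ℕ) : natPrefixComplexity U n ≤ complexityApprox G E n s := by
  induction s with
  | zero => exact hG n 0
  | succ s ih =>
    rw [complexityApprox_succ]
    cases h : E s with
    | none => exact ih
    | some q =>
      simp only [Option.elim_some, Bool.cond_eq_ite, decide_eq_true_eq]
      split_ifs with hq
      · exact le_min ih (prefixComplexity_le (hq ▸ hmem s q.1 q.2 h))
      · exact ih

theorem IsUniversalPrefixFreeMachine.exists_complexityApprox_le
    (hU : IsUniversalPrefixFreeMachine U) {E : ℕ → Option (List Bool × List Bool)}
    (hex : ∀ p x, x ∈ U p → ∃ i, E i = some (p, x)) (G : ℕ → ℕ → ℕ) (n : ℕ) :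
    ∃ s, ∀ u ≥ s, complexityApprox G E n u ≤ natPrefixComplexity U n := by
  obtain ⟨p, hp, hl⟩ := hU.exists_length_eq n.bits
  obtain ⟨i, hi⟩ := hex p _ hp
  refine ⟨i + 1, fun u hu => (complexityApprox_antitone G E n hu).trans ?_⟩
  rw [complexityApprox_succ, hi]
  simp only [Option.elim_some, decide_true, cond_true]
  exact (min_le_right _ _).trans hl.le

/-- Kraft's inequality for the complexities of the natural numbers. -/
theorem IsUniversalPrefixFreeMachine.sum_natPrefixComplexity_le_one
    (hU : IsUniversalPrefixFreeMachine U) (s : ℕ) :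
    ∑ n ∈ Finset.range s, (1 / 2 : ℝ) ^ natPrefixComplexity U n ≤ 1 := by
  have h : ∀ n : ℕ, ∃ p, n.bits ∈ U p ∧ p.length = natPrefixComplexity U n := fun n =>
    hU.exists_length_eq n.bits
  choose p hp hl using h
  have hinj : Function.Injective p := fun m n hmn => by
    have := Part.mem_unique (hp m) (hmn ▸ hp n)
    rw [← bitsToNat_bits m, this, bitsToNat_bits]
  have := sum_two_pow_length_le_one (S := (Finset.range s).image p) fun x hx y hy hxy => by
    obtain ⟨m, -, rfl⟩ := Finset.mem_image.1 hx
    obtain ⟨n, -, rfl⟩ := Finset.mem_image.1 hy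
    exact hU.1.2 _ _ (Part.dom_iff_mem.2 ⟨_, hp m⟩) (Part.dom_iff_mem.2 ⟨_, hp n⟩) hxy
  rw [Finset.sum_image hinj.injOn] at this
  simpa only [hl] using this

theorem IsUniversalPrefixFreeMachine.not_countable_setOf_isTrivialFor
    (hU : IsUniversalPrefixFreeMachine U) {g : ℕ → ℝ} (hg : IsRightCE g)
    (hb : IsComplexityUpperBound U g) (hw : ¬ IsWeakSolovay U g) :
    ¬ {A : ℕ → Bool | IsTrivialFor U g A}.Countable := by
  obtain ⟨G, C, hGc, hGm, hGK, hgG, hGg⟩ := hg.exists_nat_approximation hb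
  obtain ⟨E, hE, hmem, hex, -⟩ := exists_enumeration_of_partrec hU.1.1
  have hK := hU.sum_natPrefixComplexity_le_one
  obtain ⟨Φ, hΦ, htriv⟩ := hU.exists_injective_le hGc (computable_complexityApprox hGc hE) hGm
    (complexityApprox_antitone G E)
    (fun s => (Finset.sum_le_sum fun n _ => half_pow_le (le_complexityApprox hmem hGK n s)).trans
      (hK s))
    (fun s => (Finset.sum_le_sum fun n _ => half_pow_le (hGK n s)).trans (hK s))
    (fun k => by
      -- If this set were infinite, 2k would witness that g is a weak Solovay function. Its
      -- finiteness gives the growing gap between G and K.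
      have hfin : {n : ℕ | g n ≤ (natPrefixComplexity U n : ℝ) + (2 * k : ℕ)}.Finite := by
        by_contra hinf
        exact hw ⟨hg, hb, 2 * k, hinf⟩
      obtain ⟨N, hN⟩ := hfin.bddAbove
      refine ⟨N + 1, fun n hn => ?_⟩
      obtain ⟨s, hs⟩ := hU.exists_complexityApprox_le hex G n
      refine ⟨s, fun u hu => ?_⟩
      have h1 : (natPrefixComplexity U n : ℝ) + (2 * k : ℕ) < g n := by
        by_contra hle
        have := hN (show n ∈ {n : ℕ | _} from not_lt.1 hle)
        omega
      have h2 : natPrefixComplexity U n + 2 * k ≤ G n u := by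
        exact_mod_cast h1.le.trans (hgG n u)
      have := hs u hu
      omega)
  intro hcount
  have hsub : Set.range Φ ⊆ {A : ℕ → Bool | IsTrivialFor U g A} := by
    rintro _ ⟨X, rfl⟩
    obtain ⟨c, hc⟩ := htriv X
    refine ⟨C + c, fun n => ?_⟩
    obtain ⟨t, ht⟩ := hGg n
    have h1 : (prefixComplexity U (initialSegment (Φ X) n) : ℝ) ≤ G n t + c := by
      exact_mod_cast hc n t
    push_cast
    linarith
  have huniv : (Set.univ : Set (ℕ → Bool)).Countable := by
    rw [← Set.preimage_range Φ]
    exact (hcount.mono hsub).preimage hΦ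
  have := Set.countable_univ_iff.1 huniv
  obtain ⟨f, hf⟩ := exists_surjective_nat (ℕ → Bool)
  obtain ⟨n, hn⟩ := hf fun n => !f n n
  simpa using congrFun hn n

/-- A string of n zeros is computable from n, so the zero sequence is K-trivial. -/
theorem IsUniversalPrefixFreeMachine.exists_initialSegment_false_le
    (hU : IsUniversalPrefixFreeMachine U) : ∃ c, ∀ n,
      prefixComplexity U (initialSegment (fun _ => false) n) ≤ natPrefixComplexity U n + c := by
  have hf : Computable fun x : List Bool => initialSegment (fun _ => false) (bitsToNat x) := by
    have := computable_bitsToNat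
    exact Computable.map_range (f := fun (_ : List Bool) _ => false) (Computable.const false) this
  obtain ⟨c, hc⟩ := hU.exists_map_le hf
  exact ⟨c, fun n => by simpa only [natPrefixComplexity, bitsToNat_bits] using hc n.bits⟩

theorem IsUniversalPrefixFreeMachine.exists_natPrefixComplexity_le
    (hU : IsUniversalPrefixFreeMachine U) : ∃ c, ∀ (A : ℕ → Bool) (n : ℕ),
      natPrefixComplexity U n ≤ prefixComplexity U (initialSegment A n) + c := by
  obtain ⟨c, hc⟩ := hU.exists_map_le (f := fun x => x.length.bits) (by fun_prop)
  exact ⟨c, fun A n => by simpa only [natPrefixComplexity, initialSegment_length] using hc (initialSegment A n)⟩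

/-- A prefix of length n determines n, so K(n) is at most its complexity plus a constant. -/
theorem IsUniversalPrefixFreeMachine.isComplexityUpperBound_of_isTrivialFor
    (hU : IsUniversalPrefixFreeMachine U) {g : ℕ → ℝ} {A : ℕ → Bool} (hA : IsTrivialFor U g A) :
    IsComplexityUpperBound U g := by
  obtain ⟨b, hb⟩ := hA
  obtain ⟨c, hc⟩ := hU.exists_natPrefixComplexity_le
  refine ⟨b + c, fun n => ?_⟩
  have h1 : (natPrefixComplexity U n : ℝ) ≤ prefixComplexity U (initialSegment A n) + c := by
    exact_mod_cast hc A n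
  have h2 := hb n
  push_cast
  linarith

end Approximation

/-! ### The main theorem -/

theorem theorem4p7 (U : List Bool →. List Bool) (hU : IsUniversalPrefixFreeMachine U) :
    (∀ g : ℕ → ℝ, IsRightCE g → IsComplexityUpperBound U g → ¬ IsWeakSolovay U g →
      ¬ {A : ℕ → Bool | IsTrivialFor U g A}.Countable) ∧
    {A : ℕ → Bool | IsKTrivial U A}.Countable ∧
    (∀ g : ℕ → ℝ, IsRightCE g → (∀ A : ℕ → Bool, IsKTrivial U A ↔ IsTrivialFor U g A) →
      IsWeakSolovay U g) := by
  refine ⟨fun g hg hb hw => hU.not_countable_setOf_isTrivialFor hg hb hw,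
    hU.countable_setOf_isKTrivial, fun g hg hiff => ?_⟩
  -- The zero sequence is K-trivial, hence g-trivial by the assumed equivalence. This supplies the
  -- upper bound that the uncountability statement needs.
  have hb := hU.isComplexityUpperBound_of_isTrivialFor
    ((hiff _).1 hU.exists_initialSegment_false_le)
  by_contra hw
  refine hU.not_countable_setOf_isTrivialFor hg hb hw ?_
  simp only [← hiff]
  exact hU.countable_setOf_isKTrivial
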